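/- Let $\ell\ge 1$, $\mathbb N=\{0,1,2,\dots\}$, and let $\overline{\mathbb N}=\mathbb N\cup\{\infty\}$ be the one-point compactification of $\mathbb N$. **The inverse semigroup $T$.** On $\ell^2(\mathbb N)$ let $S$ be the left shift ($Se_n=e_{n-1}$, $Se_0=0$) and $p$ the projection onto $\mathbb C e_0$; on $\ell^2(\mathbb Z)$ let $t$ be the right shift. For $1\le k\le\ell$, $m,n\in\mathbb N^\ell$ and $r\in\mathbb Z$ put $$B_k(r,m,n)=S^{*m_1}pS^{n_1}\otimes\cdots\otimes S^{*m_{k-1}}pS^{n_{k-1}}\otimes S^{*m_k}S^{n_k}\otimes 1\otimes\cdots\otimes 1\otimes t^{\sum_{i=1}^k(m_i-n_i)},$$ $$B_{\ell+1}(r,m,n)=S^{*m_1}pS^{n_1}\otimes\cdots\otimes S^{*m_\ell}pS^{n_\ell}\otimes t^{\,r+\sum_{i=1}^\ell(m_i-n_i)},$$ operators on $\ell^2(\mathbb N)^{\otimes\ell}\otimes\ell^2(\mathbb Z)$. Then $T=\{0\}\cup\{B_k(r,m,n):1\le k\le\ell+1\}$ is an inverse semigroup with zero under composition and adjoint. Let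 $E$ be its set of projections and put $p_k(m)=B_k(0,m,m)$. **The groupoid $\mathcal G_{tight}$.** Let $\hat E_0$ be the space of nonzero multiplicative maps $x:E\to\{0,1\}$ with $x(0)=0$, with the topology of pointwise convergence, and let $\hat E_{tight}$ be the closure of the set of those $x$ for which $\{e:x(e)=1\}$ is a maximal filter. For $s\in T$ and $x\in D_s=\{x\in\hat E_0:x(ss^*)=1\}$ put $(x.s)(e)=x(ses^*)$. Let $[x,s]$ denote the class of a pair $(x,s)$ with $x\in D_s$ under the relation: $(x,s)\sim(y,t)$ if $x=y$ and $es=et$ for some $e\in E$ with $x(e)=1$. These classes form a groupoid with product $[x,s][x.s,t]=[x,st]$ and inverse $[x,s]^{-1}=[x.s,s^*]$; the sets $\{[x,s]:x\in U\}$, with $s\in T$ and $U\subseteq D_s$ open, generate its topology. $\mathcal G_{tight}$ is the reduction of this groupoid to $\hat E_{tight}$, with the subspace topology. **Sheu's groupoid $\mathcal G$.** Let $\Sigma$ be the set of $(z,x,w)\in\mathbb Z\times\mathbb Z^\ell\times\overline{\mathbb N}^\ell$ with $x+w\in\overline{\mathbb N}^\ell$ such that, whenever $w_i=\infty$, one has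 $x_{i+1}=\cdots=x_\ell=0$ and $z=-\sum_{j=1}^i x_j$. It carries the subspace topology, the product $(z,x,w)(z',x',x+w)=(z+z',x+x',w)$ and the inverse $(z,x,w)^{-1}=(-z,-x,x+w)$. Let $\sim$ be the equivalence relation on $\Sigma$ generated by $$(z,x,w_1,\dots,w_{i-1},\infty,w_{i+1},\dots,w_\ell)\sim(z,x,w_1,\dots,w_{i-1},\infty,\infty,\dots,\infty),$$ and let $\mathcal G=\Sigma/\!\sim$, with the induced product and inverse and the quotient topology. **The map $\psi$.** For $w\in\overline{\mathbb N}^\ell$ set $w_{\ell+1}=\infty$ and let $r\ge 0$ be least with $w_{r+1}=\infty$. Let $\phi(w)\in\hat E_0$ be the indicator function of the filter $$\{f\in E: f\ge p_{r+1}(m)\text{ for some }m\in\mathbb N^\ell\text{ with }m_j=w_j\text{ for all }j\le r\}.$$ For $(z,x,w)\in\Sigma$, with this $r$, define $$\psi(z,x,w)=[\phi(w),B_{r+1}(t,m,n)],\qquad t=z+\sum_{j=1}^r x_j,$$ $$m=(w_1,\dots,w_r,|x_{r+1}|,0,\dots,0),\qquad n=(x_1+w_1,\dots,x_r+w_r,x_{r+1}+|x_{r+1}|,0,\dots,0)$$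 (with no $(r+1)$-st entries if $r=\ell$). **Proposition.** The map $\psi$ takes values in $\mathcal G_{tight}$, is continuous as a map $\Sigma\to\mathcal G_{tight}$, and is constant on the classes of $\sim$. The induced map $\tilde\psi:\mathcal G\to\mathcal G_{tight}$ is an isomorphism of topological groupoids: it is a homeomorphism, two elements $g,h$ of $\mathcal G$ are composable if and only if $\tilde\psi(g),\tilde\psi(h)$ are, and then $\tilde\psi(gh)=\tilde\psi(g)\tilde\psi(h)$; and $\tilde\psi(g^{-1})=\tilde\psi(g)^{-1}$. -/

import Mathlib

namespace QSphere

noncomputable section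

/-! ## Groupoids and their isomorphisms -/

/-- A groupoid, presented as a set `G` of arrows with a partially defined product
(`pmul a b = some c` means that `(a, b)` is composable with product `c`) and an inversion. -/
class ArrowGroupoid (G : Type*) where
  pmul : G → G → Option G
  inv : G → G
  inv_inv : ∀ a, inv (inv a) = a
  assoc : ∀ a b c u v, pmul a b = some u → pmul b c = some v →
    ∃ w, pmul u c = some w ∧ pmul a v = some w
  inv_comp : ∀ a, ∃ u, pmul (inv a) a = some u
  comp_inv : ∀ a, ∃ u, pmul a (inv a) = some u
  inv_mul_cancel : ∀ a b c, pmul a b = some c → pmul (inv a) c = some b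
  mul_inv_cancel : ∀ a b c, pmul a b = some c → pmul c (inv b) = some a

/-- An isomorphism of topological groupoids: a homeomorphism `f` such that `(a, b)` is composable
if and only if `(f a, f b)` is, and then `f (a b) = f a f b`; it commutes with inversion. -/
structure TopGroupoidIso (G H : Type*) [ArrowGroupoid G] [ArrowGroupoid H]
    [TopologicalSpace G] [TopologicalSpace H] extends G ≃ₜ H where
  map_pmul : ∀ a b : G, ArrowGroupoid.pmul (toFun a) (toFun b) =
    (ArrowGroupoid.pmul a b).map toFun
  map_inv : ∀ a : G, toFun (ArrowGroupoid.inv a) = ArrowGroupoid.inv (toFun a)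

/-! ## Inverse semigroups with zero -/

/-- An inverse semigroup with `0`: every `s` has a unique `star s` with
`s (star s) s = s` and `(star s) s (star s) = star s`. -/
class InverseSemigroup₀ (T : Type*) extends SemigroupWithZero T, Star T where
  mul_star_mul : ∀ s : T, s * star s * s = s
  star_mul_star : ∀ s : T, star s * s * star s = star s
  star_unique : ∀ s u : T, s * u * s = s → u * s * u = u → u = star s

namespace InverseSemigroup₀

section
variable {T : Type*} [InverseSemigroup₀ T]

theorem star_star (s : T) : star (star s) = s :=
  (star_unique (star s) s (star_mul_star s) (mul_star_mul s)).symm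

theorem star_of_idem {e : T} (h : e * e = e) : star e = e :=
  (star_unique e e (by rw [h, h]) (by rw [h, h])).symm

theorem idem_mul {e f : T} (he : e * e = e) (hf : f * f = f) : e * f * (e * f) = e * f := by
  have h1 : e * f * star (e * f) * (e * f) = e * f := mul_star_mul (e * f)
  have h2 : star (e * f) * (e * f) * star (e * f) = star (e * f) := star_mul_star (e * f)
  set x := star (e * f) with hx
  have he' : ∀ y : T, e * (e * y) = e * y := fun y => by rw [← mul_assoc, he]
  have hf' : ∀ y : T, f * (f * y) = f * y := fun y => by rw [← mul_assoc, hf]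
  have h2' : ∀ y, x * (e * (f * (x * y))) = x * y := fun y => by
    have := congrArg (· * y) h2
    simpa [mul_assoc] using this
  have h3 : f * x * e = x := by
    apply star_unique (e * f)
    · simp only [mul_assoc, he', hf'] at h1 ⊢
      exact h1
    · simp only [mul_assoc, he', hf', h2']
  have h4 : x * x = x := by
    have : f * x * e * (f * x * e) = f * x * e := by
      simp only [mul_assoc, h2']
    rwa [h3] at this
  have h5 : e * f = x := by
    have := star_of_idem h4
    rw [hx, star_star] at this
    rw [← hx] at this
    exact this
  rw [h5, h4]

theorem idem_comm {e f : T} (he : e * e = e) (hf : f * f = f) : e * f = f * e := by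
  have h1 := idem_mul he hf
  have h2 := idem_mul hf he
  have he' : ∀ y : T, e * (e * y) = e * y := fun y => by rw [← mul_assoc, he]
  have hf' : ∀ y : T, f * (f * y) = f * y := fun y => by rw [← mul_assoc, hf]
  have h3 : f * e = star (e * f) := by
    apply star_unique
    · simp only [mul_assoc, he', hf'] at h1 ⊢
      exact h1
    · simp only [mul_assoc, he', hf'] at h2 ⊢
      exact h2
  rw [h3, star_of_idem h1]

theorem idem_left (s : T) : s * star s * (s * star s) = s * star s := by
  rw [← mul_assoc, mul_star_mul]

theorem idem_right (s : T) : star s * s * (star s * s) = star s * s := by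
  rw [← mul_assoc, star_mul_star]

theorem star_mul' (s t : T) : star (s * t) = star t * star s := by
  have h := idem_comm (idem_right s) (idem_left t)
  refine (star_unique (s * t) _ ?_ ?_).symm
  · calc s * t * (star t * star s) * (s * t) = s * (t * star t * (star s * s)) * t := by
          simp only [mul_assoc]
      _ = s * star s * s * (t * star t * t) := by rw [← h]; simp only [mul_assoc]
      _ = s * t := by rw [mul_star_mul, mul_star_mul]
  · calc star t * star s * (s * t) * (star t * star s)
          = star t * (star s * s * (t * star t)) * star s := by simp only [mul_assoc]
      _ = star t * t * star t * (star s * s * star s) := by rw [h]; simp only [mul_assoc]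
      _ = star t * star s := by rw [star_mul_star, star_mul_star]

theorem star_zero' : star (0 : T) = 0 := star_of_idem (by simp)

variable (T) in
/-- The projections of `T`. -/
def Proj : Type _ := {e : T // star e = e ∧ e * e = e}

theorem proj_comm (e f : Proj T) : e.1 * f.1 = f.1 * e.1 := idem_comm e.2.2 f.2.2

instance : Mul (Proj T) :=
  ⟨fun e f => ⟨e.1 * f.1, star_of_idem (idem_mul e.2.2 f.2.2), idem_mul e.2.2 f.2.2⟩⟩

instance : Zero (Proj T) := ⟨⟨0, star_zero', by simp⟩⟩

theorem conj_idem (s : T) (e : Proj T) : s * e.1 * star s * (s * e.1 * star s) = s * e.1 * star s := by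
  calc s * e.1 * star s * (s * e.1 * star s) = s * (e.1 * (star s * s)) * e.1 * star s := by
        simp only [mul_assoc]
    _ = s * star s * s * (e.1 * e.1) * star s := by
        rw [idem_comm e.2.2 (idem_right s)]; simp only [mul_assoc]
    _ = s * e.1 * star s := by rw [mul_star_mul, e.2.2]

/-- The projection `s e (star s)`. -/
def conj (s : T) (e : Proj T) : Proj T :=
  ⟨s * e.1 * star s, star_of_idem (conj_idem s e), conj_idem s e⟩

/-- The projection `s (star s)`. -/
def rangeProj (s : T) : Proj T := ⟨s * star s, star_of_idem (idem_left s), idem_left s⟩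

variable (T) in
/-- The space of characters of the semigroup of projections: nonzero multiplicative maps to
`{0, 1}` that vanish at `0`, with the subspace topology of the product space `{0, 1}^E`. -/
abbrev Character : Type _ :=
  {x : Proj T → Bool // (∀ e f, x (e * f) = (x e && x f)) ∧ x 0 = false ∧ ∃ e, x e = true}

/-- A character whose support is an ultrafilter, that is, a maximal filter. -/
def IsUltra (x : Character T) : Prop :=
  ∀ y : Character T, (∀ e, x.1 e = true → y.1 e = true) → ∀ e, y.1 e = true → x.1 e = true

variable (T) in
/-- The tight characters: the closure of the set of characters given by ultrafilters. -/
def tightSpectrum : Set (Character T) := closure {x | IsUltra x}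

/-- The domain `D_s` of the partial action of `s`. -/
def domain (s : T) : Set (Character T) := {x | x.1 (rangeProj s) = true}

theorem conj_mul (s : T) (e f : Proj T) : conj s (e * f) = conj s e * conj s f := by
  apply Subtype.ext
  change s * (e.1 * f.1) * star s = s * e.1 * star s * (s * f.1 * star s)
  calc s * (e.1 * f.1) * star s = s * star s * s * (e.1 * f.1) * star s := by rw [mul_star_mul]
    _ = s * (star s * s * e.1) * f.1 * star s := by simp only [mul_assoc]
    _ = _ := by rw [idem_comm (idem_right s) e.2.2]; simp only [mul_assoc]

theorem conj_rangeProj (s t : T) : conj s (rangeProj t) = rangeProj (s * t) := by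
  apply Subtype.ext
  change s * (t * star t) * star s = s * t * star (s * t)
  rw [star_mul']; simp only [mul_assoc]

theorem conj_conj (s t : T) (e : Proj T) : conj s (conj t e) = conj (s * t) e := by
  apply Subtype.ext
  change s * (t * e.1 * star t) * star s = s * t * e.1 * star (s * t)
  rw [star_mul']; simp only [mul_assoc]

theorem conj_star_conj (s : T) (e : Proj T) :
    conj s (conj (star s) e) = rangeProj s * e * rangeProj s := by
  apply Subtype.ext
  change s * (star s * e.1 * star (star s)) * star s = s * star s * e.1 * (s * star s)
  rw [star_star]; simp only [mul_assoc]

theorem conj_rangeProj_star (s : T) : conj s (rangeProj (star s)) = rangeProj s := by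
  apply Subtype.ext
  change s * (star s * star (star s)) * star s = s * star s
  rw [star_star, ← mul_assoc, mul_star_mul]

/-- The right action `(x.s)(e) = x(s e (star s))` of `s` on a character `x` in its domain. -/
def act (x : Character T) (s : T) (h : x ∈ domain s) : Character T :=
  ⟨fun e => x.1 (conj s e),
    fun e f => by
      change x.1 (conj s (e * f)) = _
      rw [conj_mul, x.2.1],
    by
      have : conj s (0 : Proj T) = 0 := Subtype.ext (by
        change s * 0 * star s = 0
        simp)
      change x.1 (conj s 0) = false
      rw [this, x.2.2.1],
    ⟨rangeProj (star s), by
      change x.1 (conj s (rangeProj (star s))) = true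
      rw [conj_rangeProj_star]; exact h⟩⟩

variable (T) in
/-- The transformation groupoid of pairs `(x, s)` with `x` in the domain of `s`. -/
abbrev Transf : Type _ := {a : Character T × T // a.1 ∈ domain a.2}

/-- `(x, s) ∼ (y, t)` if `x = y` and `e s = e t` for some projection `e` with `x(e) = 1`. -/
def germRel (a b : Transf T) : Prop :=
  a.1.1 = b.1.1 ∧ ∃ e : Proj T, a.1.1.1 e = true ∧ e.1 * a.1.2 = e.1 * b.1.2

variable (T) in
def germSetoid : Setoid (Transf T) where
  r := germRel
  iseqv :=
    { refl := fun a => ⟨rfl, rangeProj a.1.2, a.2, rfl⟩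
      symm := by
        rintro a b ⟨h, e, he, hs⟩
        exact ⟨h.symm, e, h ▸ he, hs.symm⟩
      trans := by
        rintro a b c ⟨h, e, he, hs⟩ ⟨h', f, hf, ht⟩
        refine ⟨h.trans h', e * f, ?_, ?_⟩
        · rw [a.1.1.2.1, he, h, hf]; rfl
        · change e.1 * f.1 * _ = e.1 * f.1 * _
          calc e.1 * f.1 * a.1.2 = f.1 * (e.1 * a.1.2) := by rw [proj_comm, mul_assoc]
            _ = e.1 * (f.1 * b.1.2) := by
              rw [hs, ← mul_assoc, ← mul_assoc, proj_comm]
            _ = _ := by rw [ht, mul_assoc] }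

variable (T) in
/-- The groupoid of germs of the action of `T` on its characters. -/
def GermGroupoid : Type _ := Quotient (germSetoid T)

/-- The germ `[x, s]`. -/
def germ (x : Character T) (s : T) (h : x ∈ domain s) : GermGroupoid T :=
  Quotient.mk (germSetoid T) ⟨(x, s), h⟩

/-- The source `x.s` of a pair `(x, s)`. -/
def transfSrc (a : Transf T) : Character T := act a.1.1 a.1.2 a.2

theorem transfSrc_congr {a b : Transf T} (h : germRel a b) : transfSrc a = transfSrc b := by
  obtain ⟨⟨x, s⟩, ha⟩ := a
  obtain ⟨⟨y, t⟩, hb⟩ := b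
  obtain ⟨h, e, he, hs⟩ := h
  simp only at h he hs
  subst h
  have key : ∀ (u : T) (f : Proj T), x.1 (conj u f) = x.1 (conj (e.1 * u) f) := by
    intro u f
    have : conj (e.1 * u) f = e * conj u f * e := by
      apply Subtype.ext
      change e.1 * u * f.1 * star (e.1 * u) = e.1 * (u * f.1 * star u) * e.1
      rw [star_mul', e.2.1]; simp only [mul_assoc]
    rw [this, x.2.1, x.2.1, he]; simp
  apply Subtype.ext
  funext f
  change x.1 (conj s f) = x.1 (conj t f)
  rw [key s, key t, hs]

theorem mem_domain_mul {x : Character T} {s t : T} (hs : x ∈ domain s)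
    (ht : act x s hs ∈ domain t) : x ∈ domain (s * t) := by
  change x.1 _ = true
  rw [← conj_rangeProj]
  exact ht

theorem act_mem_domain_star {x : Character T} {s : T} (hs : x ∈ domain s) :
    act x s hs ∈ domain (star s) := by
  change x.1 (conj s (rangeProj (star s))) = true
  rw [conj_rangeProj_star]
  exact hs

theorem act_act {x : Character T} {s t : T} (hs : x ∈ domain s) (ht : act x s hs ∈ domain t) :
    act (act x s hs) t ht = act x (s * t) (mem_domain_mul hs ht) := by
  apply Subtype.ext
  funext e
  change x.1 (conj s (conj t e)) = x.1 _
  rw [conj_conj]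

theorem act_star {x : Character T} {s : T} (hs : x ∈ domain s) :
    act (act x s hs) (star s) (act_mem_domain_star hs) = x := by
  apply Subtype.ext
  funext e
  change x.1 (conj s (conj (star s) e)) = x.1 e
  have hs' : x.1 (rangeProj s) = true := hs
  rw [conj_star_conj, x.2.1, x.2.1, hs']
  simp

theorem transf_mul_mem {a b : Transf T} (h : b.1.1 = transfSrc a) :
    a.1.1 ∈ domain (a.1.2 * b.1.2) :=
  mem_domain_mul a.2 (by have := b.2; rw [h] at this; exact this)

/-- The inverse `(x.s, star s)` of `(x, s)`. -/
def transfInv (a : Transf T) : Transf T :=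
  ⟨(transfSrc a, star a.1.2), act_mem_domain_star a.2⟩

theorem transfInv_congr {a b : Transf T} (h : germRel a b) :
    germRel (transfInv a) (transfInv b) := by
  refine ⟨transfSrc_congr h, ?_⟩
  obtain ⟨⟨x, s⟩, ha⟩ := a
  obtain ⟨⟨y, t⟩, hb⟩ := b
  obtain ⟨h, e, he, hs⟩ := h
  simp only at h he hs
  subst h
  have hs' : star s * e.1 = star t * e.1 := by
    have := congrArg star hs
    rwa [star_mul', star_mul', e.2.1] at this
  refine ⟨conj (star s) e, ?_, ?_⟩
  · have ha' : x.1 (rangeProj s) = true := ha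
    change x.1 (conj s (conj (star s) e)) = true
    rw [conj_star_conj, x.2.1, x.2.1, ha', he]; rfl
  · change star s * e.1 * star (star s) * star s = star s * e.1 * star (star s) * star t
    have key : ∀ u : T, star u * e.1 * u * star u = star u * e.1 := by
      intro u
      calc star u * e.1 * u * star u = star u * (e.1 * (u * star u)) := by simp only [mul_assoc]
        _ = star u * u * star u * e.1 := by
          rw [idem_comm e.2.2 (idem_left u)]; simp only [mul_assoc]
        _ = _ := by rw [star_mul_star]
    rw [star_star, key s, mul_assoc (star s), hs, ← mul_assoc, hs', key t]

theorem transfMul_congr {a b a' b' : Transf T} (ha : germRel a a') (hb : germRel b b')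
    (h : b.1.1 = transfSrc a) (h' : b'.1.1 = transfSrc a') :
    germRel ⟨(a.1.1, a.1.2 * b.1.2), transf_mul_mem h⟩
      ⟨(a'.1.1, a'.1.2 * b'.1.2), transf_mul_mem h'⟩ := by
  obtain ⟨⟨x, s⟩, hxs⟩ := a
  obtain ⟨⟨x', s'⟩, hxs'⟩ := a'
  obtain ⟨⟨y, t⟩, hyt⟩ := b
  obtain ⟨⟨y', t'⟩, hyt'⟩ := b'
  obtain ⟨h1, e, he, hs⟩ := ha
  obtain ⟨h2, f, hf, ht⟩ := hb
  simp only at h1 he hs h2 hf ht h h'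
  subst h1 h2
  refine ⟨rfl, e * conj s f, ?_, ?_⟩
  · change x.1 (e * conj s f) = true
    rw [x.2.1, he]
    rw [h] at hf
    have : x.1 (conj s f) = true := hf
    rw [this]; rfl
  · have c1 : e.1 * (conj s f).1 = (conj s f).1 * e.1 := proj_comm _ _
    have c2 : (conj s f).1 * s = s * f.1 := by
      change s * f.1 * star s * s = s * f.1
      calc s * f.1 * star s * s = s * (f.1 * (star s * s)) := by simp only [mul_assoc]
        _ = s * star s * s * f.1 := by
          rw [idem_comm f.2.2 (idem_right s)]; simp only [mul_assoc]
        _ = _ := by rw [mul_star_mul]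
    change e.1 * (conj s f).1 * (s * t) = e.1 * (conj s f).1 * (s' * t')
    calc e.1 * (conj s f).1 * (s * t) = e.1 * ((conj s f).1 * s) * t := by
          simp only [mul_assoc]
      _ = e.1 * s * (f.1 * t) := by rw [c2]; simp only [mul_assoc]
      _ = e.1 * (s * f.1) * t' := by rw [ht]; simp only [mul_assoc]
      _ = e.1 * (conj s f).1 * s * t' := by rw [← c2]; simp only [mul_assoc]
      _ = (conj s f).1 * (e.1 * s) * t' := by rw [c1]; simp only [mul_assoc]
      _ = _ := by rw [hs, c1]; simp only [mul_assoc]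

open Classical in
/-- The product `[x, s] [y, t] = [x, s t]`, defined if `y = x.s`. -/
def germMul (g h : GermGroupoid T) : Option (GermGroupoid T) :=
  Quotient.liftOn₂ g h
    (fun a b => if hab : b.1.1 = transfSrc a then
      some (germ a.1.1 (a.1.2 * b.1.2) (transf_mul_mem hab)) else none)
    (by
      intro a b a' b' ha hb
      have e1 : (b.1.1 = transfSrc a) = (b'.1.1 = transfSrc a') := by
        rw [transfSrc_congr ha, hb.1]
      by_cases h : b.1.1 = transfSrc a
      · have h' : b'.1.1 = transfSrc a' := e1 ▸ h
        rw [dif_pos h, dif_pos h']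
        exact congrArg some (Quotient.sound (transfMul_congr ha hb h h'))
      · have h' : ¬ b'.1.1 = transfSrc a' := e1 ▸ h
        rw [dif_neg h, dif_neg h'])

/-- The inversion `[x, s]⁻¹ = [x.s, star s]`. -/
def germInv (g : GermGroupoid T) : GermGroupoid T :=
  Quotient.map transfInv (fun _ _ h => transfInv_congr h) g

/-- The range `x` of `[x, s]`. -/
def germRng (g : GermGroupoid T) : Character T :=
  Quotient.liftOn g (fun a => a.1.1) (fun _ _ h => h.1)

/-- The source `x.s` of `[x, s]`. -/
def germSrc (g : GermGroupoid T) : Character T :=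
  Quotient.liftOn g transfSrc (fun _ _ h => transfSrc_congr h)

theorem germMul_eq_some {a b : Transf T} (h : b.1.1 = transfSrc a) :
    germMul (Quotient.mk (germSetoid T) a) (Quotient.mk (germSetoid T) b) =
      some (germ a.1.1 (a.1.2 * b.1.2) (transf_mul_mem h)) := dif_pos h

theorem germMul_eq_some_iff {a b : Transf T} {c : GermGroupoid T} :
    germMul (Quotient.mk (germSetoid T) a) (Quotient.mk (germSetoid T) b) = some c ↔
      ∃ h : b.1.1 = transfSrc a, c = germ a.1.1 (a.1.2 * b.1.2) (transf_mul_mem h) := by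
  by_cases h : b.1.1 = transfSrc a
  · rw [germMul_eq_some h]
    simp [h, eq_comm]
  · have : germMul (Quotient.mk (germSetoid T) a) (Quotient.mk (germSetoid T) b) = none :=
      dif_neg h
    rw [this]
    simp [h]

theorem transfSrc_mul {a b : Transf T} (h : b.1.1 = transfSrc a) :
    transfSrc ⟨(a.1.1, a.1.2 * b.1.2), transf_mul_mem h⟩ = transfSrc b := by
  obtain ⟨⟨y, t⟩, hb⟩ := b
  simp only at h
  subst h
  exact (act_act a.2 hb).symm

theorem transfSrc_inv (a : Transf T) : transfSrc (transfInv a) = a.1.1 := act_star a.2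

instance : ArrowGroupoid (GermGroupoid T) where
  pmul := germMul
  inv := germInv
  inv_inv := by
    rintro ⟨a⟩
    refine congrArg (Quotient.mk (germSetoid T)) (Subtype.ext (Prod.ext (act_star a.2) ?_))
    exact star_star a.1.2
  assoc := by
    rintro ⟨a⟩ ⟨b⟩ ⟨c⟩ u v h1 h2
    obtain ⟨k1, rfl⟩ := germMul_eq_some_iff.1 h1
    obtain ⟨k2, rfl⟩ := germMul_eq_some_iff.1 h2
    refine ⟨germ a.1.1 (a.1.2 * b.1.2 * c.1.2)
      (transf_mul_mem (a := ⟨(a.1.1, a.1.2 * b.1.2), transf_mul_mem k1⟩)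
        (k2.trans (transfSrc_mul k1).symm)),
      germMul_eq_some (k2.trans (transfSrc_mul k1).symm), ?_⟩
    refine (germMul_eq_some (a := a) (b := ⟨(b.1.1, b.1.2 * c.1.2), transf_mul_mem k2⟩) k1).trans ?_
    simp only [mul_assoc]
  inv_comp := by
    rintro ⟨a⟩
    exact ⟨_, germMul_eq_some (transfSrc_inv a).symm⟩
  comp_inv := by
    rintro ⟨a⟩
    exact ⟨_, germMul_eq_some (b := transfInv a) rfl⟩
  inv_mul_cancel := by
    rintro ⟨a⟩ ⟨b⟩ c h
    obtain ⟨k, rfl⟩ := germMul_eq_some_iff.1 h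
    refine (germMul_eq_some (a := transfInv a)
      (b := ⟨(a.1.1, a.1.2 * b.1.2), transf_mul_mem k⟩) (transfSrc_inv a).symm).trans ?_
    refine congrArg some (Quotient.sound ⟨k.symm, rangeProj (star a.1.2),
      act_mem_domain_star a.2, ?_⟩)
    change star a.1.2 * star (star a.1.2) * (star a.1.2 * (a.1.2 * b.1.2)) =
      star a.1.2 * star (star a.1.2) * b.1.2
    rw [star_star, ← mul_assoc, ← mul_assoc, star_mul_star, mul_assoc]
  mul_inv_cancel := by
    rintro ⟨a⟩ ⟨b⟩ c h
    obtain ⟨k, rfl⟩ := germMul_eq_some_iff.1 h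
    refine (germMul_eq_some (a := ⟨(a.1.1, a.1.2 * b.1.2), transf_mul_mem k⟩)
      (b := transfInv b) (transfSrc_mul k).symm).trans ?_
    refine congrArg some (Quotient.sound ⟨rfl, rangeProj (a.1.2 * b.1.2),
      transf_mul_mem k, ?_⟩)
    change a.1.2 * b.1.2 * star (a.1.2 * b.1.2) * (a.1.2 * b.1.2 * star b.1.2) =
      a.1.2 * b.1.2 * star (a.1.2 * b.1.2) * a.1.2
    generalize a.1.2 = s
    generalize b.1.2 = t
    have kk : s * t * star (s * t) * s = s * t * star t := by
      rw [star_mul']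
      calc s * t * (star t * star s) * s = s * ((t * star t) * (star s * s)) := by
            simp only [mul_assoc]
        _ = s * star s * s * (t * star t) := by
            rw [← idem_comm (idem_right s) (idem_left t)]; simp only [mul_assoc]
        _ = _ := by rw [mul_star_mul, mul_assoc]
    rw [kk]
    calc s * t * star (s * t) * (s * t * star t)
          = (s * t * star (s * t) * s) * (t * star t) := by simp only [mul_assoc]
      _ = s * (t * star t * (t * star t)) := by rw [kk]; simp only [mul_assoc]
      _ = _ := by rw [idem_left, mul_assoc]

/-- The topology on germs generated by the sets `{[x, s] : x ∈ U}`, for `s` in `T` and `U` an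
open subset of the domain of `s` (the domain of `s` is open in the space of characters). -/
instance : TopologicalSpace (GermGroupoid T) :=
  TopologicalSpace.generateFrom
    {θ | ∃ (s : T) (U : Set (Character T)) (hU : U ⊆ domain s), IsOpen U ∧
      θ = {g | ∃ (x : Character T) (hx : x ∈ U), g = germ x s (hU hx)}}

variable (T) in
/-- The tight groupoid: the reduction of the groupoid of germs to the tight characters. -/
abbrev TightGroupoid : Type _ :=
  {g : GermGroupoid T // germRng g ∈ tightSpectrum T ∧ germSrc g ∈ tightSpectrum T}

theorem germInv_mem (g : TightGroupoid T) :
    germRng (germInv g.1) ∈ tightSpectrum T ∧ germSrc (germInv g.1) ∈ tightSpectrum T := by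
  obtain ⟨⟨a⟩, h⟩ := g
  refine ⟨h.2, ?_⟩
  have : germSrc (germInv (Quot.mk _ a : GermGroupoid T)) = a.1.1 := transfSrc_inv a
  rw [this]
  exact h.1

theorem germMul_mem (g h : TightGroupoid T) (k : GermGroupoid T) (hk : germMul g.1 h.1 = some k) :
    germRng k ∈ tightSpectrum T ∧ germSrc k ∈ tightSpectrum T := by
  obtain ⟨⟨a⟩, ha⟩ := g
  obtain ⟨⟨b⟩, hb⟩ := h
  obtain ⟨h, rfl⟩ := germMul_eq_some_iff.1 hk
  refine ⟨ha.1, ?_⟩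
  have : germSrc (germ a.1.1 (a.1.2 * b.1.2) (transf_mul_mem h)) = transfSrc b := transfSrc_mul h
  rw [this]
  exact hb.2

/-- The product of the reduction is that of the groupoid of germs. -/
def tightMul (g h : TightGroupoid T) : Option (TightGroupoid T) :=
  (germMul g.1 h.1).pmap Subtype.mk (germMul_mem g h)

theorem tightMul_eq_some_iff {g h k : TightGroupoid T} :
    tightMul g h = some k ↔ germMul g.1 h.1 = some k.1 := by
  unfold tightMul
  rw [Option.pmap_eq_some_iff]
  constructor
  · rintro ⟨a, h1, h2, rfl⟩
    exact h2
  · intro hk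
    exact ⟨k.1, k.2, hk, rfl⟩

instance : ArrowGroupoid (TightGroupoid T) where
  pmul := tightMul
  inv g := ⟨germInv g.1, germInv_mem g⟩
  inv_inv g := Subtype.ext (ArrowGroupoid.inv_inv g.1)
  assoc a b c u v h1 h2 := by
    obtain ⟨w, hw, hw'⟩ := ArrowGroupoid.assoc a.1 b.1 c.1 u.1 v.1 (tightMul_eq_some_iff.1 h1)
      (tightMul_eq_some_iff.1 h2)
    exact ⟨⟨w, germMul_mem u c w hw⟩, tightMul_eq_some_iff.2 hw, tightMul_eq_some_iff.2 hw'⟩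
  inv_comp a := by
    obtain ⟨u, hu⟩ := ArrowGroupoid.inv_comp a.1
    exact ⟨⟨u, germMul_mem ⟨_, germInv_mem a⟩ a u hu⟩, tightMul_eq_some_iff.2 hu⟩
  comp_inv a := by
    obtain ⟨u, hu⟩ := ArrowGroupoid.comp_inv a.1
    exact ⟨⟨u, germMul_mem a ⟨_, germInv_mem a⟩ u hu⟩, tightMul_eq_some_iff.2 hu⟩
  inv_mul_cancel a b c h := tightMul_eq_some_iff.2
    (ArrowGroupoid.inv_mul_cancel a.1 b.1 c.1 (tightMul_eq_some_iff.1 h))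
  mul_inv_cancel a b c h := tightMul_eq_some_iff.2
    (ArrowGroupoid.mul_inv_cancel a.1 b.1 c.1 (tightMul_eq_some_iff.1 h))

end

end InverseSemigroup₀

/-! ## The operators `B_k(r, m, n)` and the inverse semigroup `T` -/

section partialShift
variable {ι : Type*}

theorem partialShift_sum_le (f : ι ≃. ι) (ξ : lp (fun _ : ι => ℂ) 2) (s : Finset ι) :
    ∑ i ∈ s, ‖(f i).elim 0 ξ‖ ^ (2 : ENNReal).toReal ≤ ‖ξ‖ ^ (2 : ENNReal).toReal := by
  classical
  have h2 : 0 < (2 : ENNReal).toReal := by norm_num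
  let s' : Finset ι := s.filter fun i => (f i).isSome
  have e1 : ∑ i ∈ s, ‖(f i).elim 0 ξ‖ ^ (2 : ENNReal).toReal
      = ∑ i ∈ s', ‖(f i).elim 0 ξ‖ ^ (2 : ENNReal).toReal := by
    refine (Finset.sum_subset (Finset.filter_subset _ _) ?_).symm
    intro i hi hi'
    have : f i = none := by
      by_contra h
      exact hi' (Finset.mem_filter.2 ⟨hi, Option.isSome_iff_ne_none.2 h⟩)
    rw [this]
    simp
  rw [e1]
  have e2 : ∑ i ∈ s', ‖(f i).elim 0 ξ‖ ^ (2 : ENNReal).toReal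
      = ∑ j ∈ s'.image (fun i => (f i).getD i), ‖ξ j‖ ^ (2 : ENNReal).toReal := by
    rw [Finset.sum_image]
    · refine Finset.sum_congr rfl ?_
      intro i hi
      obtain ⟨j, hj⟩ := Option.isSome_iff_exists.1 (Finset.mem_filter.1 hi).2
      rw [hj]; rfl
    · intro i hi i' hi' h
      obtain ⟨j, hj⟩ := Option.isSome_iff_exists.1 (Finset.mem_filter.1 hi).2
      obtain ⟨j', hj'⟩ := Option.isSome_iff_exists.1 (Finset.mem_filter.1 hi').2
      simp only [hj, hj', Option.getD_some] at h
      subst h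
      exact f.inj hj hj'
  rw [e2]
  exact lp.sum_rpow_le_norm_rpow h2 ξ _

/-- The partial isometry of `ℓ²(ι)` given by a partial bijection `f` of `ι`:
`(partialShift f ξ) i = ξ (f i)` where `f i` is defined, and `0` elsewhere; it maps the basis
vector `e_{f i}` to `e_i`, and `e_j` to `0` for `j` outside the range of `f`. -/
def partialShift (f : ι ≃. ι) : lp (fun _ : ι => ℂ) 2 →L[ℂ] lp (fun _ : ι => ℂ) 2 :=
  LinearMap.mkContinuous
    { toFun := fun ξ => ⟨fun i => (f i).elim 0 ξ,
        memℓp_gen' (C := ‖ξ‖ ^ (2 : ENNReal).toReal) (partialShift_sum_le f ξ)⟩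
      map_add' := by
        intro ξ η
        ext i
        change (f i).elim 0 (ξ + η : lp (fun _ : ι => ℂ) 2) = (f i).elim 0 ξ + (f i).elim 0 η
        cases f i
        · exact (add_zero (0 : ℂ)).symm
        · rfl
      map_smul' := by
        intro c ξ
        ext i
        change (f i).elim 0 (c • ξ : lp (fun _ : ι => ℂ) 2) = c • (f i).elim 0 ξ
        cases f i
        · exact (smul_zero c).symm
        · rfl }
    1 (by
      intro ξ
      rw [one_mul]
      exact lp.norm_le_of_forall_sum_le (by norm_num) (norm_nonneg ξ) (partialShift_sum_le f ξ))

theorem partialShift_apply (f : ι ≃. ι) (ξ : lp (fun _ : ι => ℂ) 2) (i : ι) :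
    partialShift f ξ i = (f i).elim 0 ξ := rfl

theorem partialShift_mul (f g : ι ≃. ι) :
    partialShift f * partialShift g = partialShift (f.trans g) := by
  ext ξ i
  change (f i).elim 0 (partialShift g ξ) = ((f i).bind g).elim 0 ξ
  cases f i <;> rfl

theorem partialShift_bot : partialShift (⊥ : ι ≃. ι) = 0 := by
  ext ξ i
  rfl

theorem partialShift_injective :
    Function.Injective (partialShift : (ι ≃. ι) → _) := by
  classical
  have key : ∀ f g : ι ≃. ι, partialShift f = partialShift g → ∀ i j, f i = some j →
      g i = some j := by
    intro f g h i j hij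
    have h1 := congrArg (fun A => A (lp.single 2 j (1 : ℂ)) i) h
    simp only [partialShift_apply, hij] at h1
    simp only [Option.elim, lp.single_apply_self] at h1
    cases hg : g i with
    | none => simp [hg] at h1
    | some j' =>
      simp only [hg] at h1
      by_contra hne
      have : j' ≠ j := fun h => hne (by rw [h])
      rw [lp.single_apply_ne _ _ _ this] at h1
      exact one_ne_zero h1
  intro f g h
  ext i j
  exact ⟨key f g h i j, key g f h.symm i j⟩

theorem partialShift_star (f : ι ≃. ι) : star (partialShift f) = partialShift f.symm := by
  rw [ContinuousLinearMap.star_eq_adjoint]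
  symm
  rw [ContinuousLinearMap.eq_adjoint_iff]
  intro ξ η
  rw [lp.inner_eq_tsum, lp.inner_eq_tsum]
  symm
  have hs : ∀ i, inner ℂ (ξ i) ((partialShift f η) i) ≠ 0 → (f i).isSome := by
    intro i hi
    by_contra h
    have : f i = none := by simpa using h
    rw [partialShift_apply, this] at hi
    simp at hi
  have hs' : ∀ j, inner ℂ ((partialShift f.symm ξ) j) (η j) ≠ 0 → (f.symm j).isSome := by
    intro i hi
    by_contra h
    have : f.symm i = none := by simpa using h
    rw [partialShift_apply, this] at hi
    simp at hi
  refine tsum_eq_tsum_of_ne_zero_bij (fun j => (f.symm j.1).get (hs' j.1 j.2)) ?_ ?_ ?_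
  · intro j j' h
    have h1 : f.symm j.1 = some _ := (Option.some_get (hs' j.1 j.2)).symm
    have h2 : f.symm j'.1 = some _ := (Option.some_get (hs' j'.1 j'.2)).symm
    simp only at h
    rw [← h] at h2
    exact Subtype.ext (f.symm.inj h1 h2)
  · intro i hi
    obtain ⟨j, hj⟩ := Option.isSome_iff_exists.1 (hs i hi)
    have hj' : f.symm j = some i := f.eq_some_iff.2 hj
    have hi' : inner ℂ (ξ i) ((partialShift f η) i) ≠ 0 := hi
    refine ⟨⟨j, ?_⟩, ?_⟩
    · rw [partialShift_apply, hj] at hi'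
      rw [Function.mem_support, partialShift_apply, hj']
      exact hi'
    · simp [hj']
  · intro j
    obtain ⟨i, hi⟩ := Option.isSome_iff_exists.1 (hs' j.1 j.2)
    have hi' : f i = some j.1 := f.eq_some_iff.1 hi
    simp only [partialShift_apply, hi, Option.get_some, hi']
    rfl

end partialShift

/-- The Hilbert space `ℓ²(ℕ)^{⊗ ℓ} ⊗ ℓ²(ℤ)`, realized as `ℓ²(ℕ^ℓ × ℤ)`. -/
abbrev Hilb (ℓ : ℕ) : Type := lp (fun _ : (Fin ℓ → ℕ) × ℤ => ℂ) 2

variable {ℓ : ℕ}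

/-- The left shift `S e_n = e_{n-1}`, `S e_0 = 0` on the `i`-th tensor factor. -/
def opS (i : Fin ℓ) : Hilb ℓ →L[ℂ] Hilb ℓ :=
  partialShift
    { toFun := fun c => some (Function.update c.1 i (c.1 i + 1), c.2)
      invFun := fun c => if c.1 i = 0 then none else some (Function.update c.1 i (c.1 i - 1), c.2)
      inv := by
        rintro ⟨a, b⟩ ⟨a', b'⟩
        simp only [Option.ite_none_left_eq_some, Option.some.injEq, Prod.mk.injEq]
        constructor
        · rintro ⟨h, rfl, rfl⟩
          refine ⟨?_, rfl⟩
          rw [Function.update_self, Function.update_idem, Nat.sub_add_cancel (by omega),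
            Function.update_eq_self]
        · rintro ⟨rfl, rfl⟩
          simp }

/-- The rank one projection `p = |e_0⟩⟨e_0|` on the `i`-th tensor factor. -/
def opP (i : Fin ℓ) : Hilb ℓ →L[ℂ] Hilb ℓ :=
  partialShift (PEquiv.ofSet {c : (Fin ℓ → ℕ) × ℤ | c.1 i = 0})

/-- The power `t^z` of the right shift `t e_b = e_{b+1}` on the tensor factor `ℓ²(ℤ)`. -/
def opT (ℓ : ℕ) (z : ℤ) : Hilb ℓ →L[ℂ] Hilb ℓ :=
  partialShift (((Equiv.refl (Fin ℓ → ℕ)).prodCongr (Equiv.subRight z)).toPEquiv)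

/-- The exponent of `t` in `B_{k+1}(r, m, n)`. -/
def expo (k : Fin (ℓ + 1)) (r : ℤ) (m n : Fin ℓ → ℕ) : ℤ :=
  (∑ i : Fin ℓ, if i.1 ≤ k.1 then (m i : ℤ) - n i else 0) + if k.1 = ℓ then r else 0

/-- The `i`-th tensor factor of `B_{k+1}(r, m, n)`. -/
def leg (k : Fin (ℓ + 1)) (m n : Fin ℓ → ℕ) (i : Fin ℓ) : Hilb ℓ →L[ℂ] Hilb ℓ :=
  if i.1 < k.1 then star (opS i) ^ m i * opP i * opS i ^ n i
  else if i.1 = k.1 then star (opS i) ^ m i * opS i ^ n i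
  else 1

/-- The operator `B_{k+1}(r, m, n)`, for `0 ≤ k ≤ ℓ`. All indices are shifted by one:
`k` runs over `0, …, ℓ` and the coordinates of `m` and `n` are numbered `0, …, ℓ - 1`. An
elementary tensor is the product of its factors, each acting on its own coordinate. -/
def opB (k : Fin (ℓ + 1)) (r : ℤ) (m n : Fin ℓ → ℕ) : Hilb ℓ →L[ℂ] Hilb ℓ :=
  ((List.finRange ℓ).map (leg k m n)).prod * opT ℓ (expo k r m n)

/-- `A` acts on the `i`-th coordinate only, by the partial map `h` with domain `P`. -/
def IsLeg (i : Fin ℓ) (P : ℕ → Prop) (h : ℕ → ℕ) (A : Hilb ℓ →L[ℂ] Hilb ℓ) : Prop :=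
  ∀ (ξ : Hilb ℓ) (a : Fin ℓ → ℕ) (b : ℤ),
    (P (a i) → A ξ (a, b) = ξ (Function.update a i (h (a i)), b)) ∧ (¬ P (a i) → A ξ (a, b) = 0)

theorem IsLeg.mul {i : Fin ℓ} {P Q : ℕ → Prop} {h g : ℕ → ℕ} {A C : Hilb ℓ →L[ℂ] Hilb ℓ}
    (hA : IsLeg i P h A) (hC : IsLeg i Q g C) :
    IsLeg i (fun x => P x ∧ Q (h x)) (fun x => g (h x)) (A * C) := by
  intro ξ a b
  change (_ → A (C ξ) (a, b) = _) ∧ (_ → A (C ξ) (a, b) = 0)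
  have hC' := hC ξ (Function.update a i (h (a i))) b
  rw [Function.update_self, Function.update_idem] at hC'
  constructor
  · rintro ⟨h1, h2⟩
    rw [(hA _ a b).1 h1, hC'.1 h2]
  · intro h1
    by_cases h2 : P (a i)
    · rw [(hA _ a b).1 h2, hC'.2 fun h3 => h1 ⟨h2, h3⟩]
    · exact (hA _ a b).2 h2

theorem IsLeg.congr {i : Fin ℓ} {P Q : ℕ → Prop} {h g : ℕ → ℕ} {A : Hilb ℓ →L[ℂ] Hilb ℓ}
    (hA : IsLeg i P h A) (hP : ∀ x, P x ↔ Q x) (hh : ∀ x, P x → h x = g x) : IsLeg i Q g A := by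
  intro ξ a b
  constructor
  · intro h1
    rw [(hA ξ a b).1 ((hP _).2 h1), hh _ ((hP _).2 h1)]
  · intro h1
    exact (hA ξ a b).2 fun h2 => h1 ((hP _).1 h2)

theorem isLeg_one (i : Fin ℓ) : IsLeg i (fun _ => True) (fun x => x) 1 := by
  intro ξ a b
  simp

theorem isLeg_opS_pow (i : Fin ℓ) (n : ℕ) :
    IsLeg i (fun _ => True) (fun x => x + n) (opS i ^ n) := by
  induction n with
  | zero => simpa using isLeg_one i
  | succ n ih =>
    rw [pow_succ]
    refine IsLeg.congr (ih.mul (Q := fun _ => True) (g := fun x => x + 1) ?_) (by simp)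
      (fun x _ => by omega)
    intro ξ a b
    refine ⟨fun _ => rfl, fun h => (h trivial).elim⟩

theorem isLeg_star_opS_pow (i : Fin ℓ) (n : ℕ) :
    IsLeg i (fun x => n ≤ x) (fun x => x - n) (star (opS i) ^ n) := by
  induction n with
  | zero => exact IsLeg.congr (by simpa using isLeg_one i) (by simp) (by simp)
  | succ n ih =>
    rw [pow_succ]
    refine IsLeg.congr (ih.mul (Q := fun x => x ≠ 0) (g := fun x => x - 1) ?_)
      (fun x => by omega) (fun x _ => by omega)
    intro ξ a b
    rw [opS, partialShift_star, partialShift_apply]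
    constructor
    · intro h
      simp [PEquiv.symm, h]
    · intro h
      have h' : a i = 0 := by simpa using h
      simp [PEquiv.symm, h']

theorem isLeg_opP (i : Fin ℓ) : IsLeg i (fun x => x = 0) (fun x => x) (opP i) := by
  intro ξ a b
  rw [opP, partialShift_apply]
  constructor
  · intro h
    rw [Function.update_eq_self]
    simp [PEquiv.ofSet, h]
  · intro h
    simp [PEquiv.ofSet, h]

/-- The condition on the `i`-th coordinate in the domain of the partial bijection `shiftB`. -/
def legDom (k : Fin (ℓ + 1)) (m : Fin ℓ → ℕ) (i : Fin ℓ) (x : ℕ) : Prop :=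
  (i.1 < k.1 → x = m i) ∧ (i.1 = k.1 → m i ≤ x)

/-- The action on the `i`-th coordinate of the partial bijection `shiftB`. -/
def legMap (k : Fin (ℓ + 1)) (m n : Fin ℓ → ℕ) (i : Fin ℓ) (x : ℕ) : ℕ :=
  if i.1 < k.1 then n i else if i.1 = k.1 then x - m i + n i else x

theorem isLeg_leg (k : Fin (ℓ + 1)) (m n : Fin ℓ → ℕ) (i : Fin ℓ) :
    IsLeg i (legDom k m i) (legMap k m n i) (leg k m n i) := by
  unfold leg legDom legMap
  split_ifs with h1 h2
  · refine IsLeg.congr (((isLeg_star_opS_pow i (m i)).mul (isLeg_opP i)).mul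
      (isLeg_opS_pow i (n i))) ?_ ?_
    · intro x
      constructor
      · intro h
        exact ⟨fun _ => by omega, fun _ => by omega⟩
      · intro h
        have := h.1 h1
        exact ⟨by omega, trivial⟩
    · intro x h
      simp only [and_true] at h
      omega
  · refine IsLeg.congr ((isLeg_star_opS_pow i (m i)).mul (isLeg_opS_pow i (n i))) ?_ ?_
    · intro x
      constructor
      · intro h
        exact ⟨fun _ => by omega, fun _ => h.1⟩
      · intro h
        exact ⟨h.2 h2, trivial⟩
    · intro x h
      rfl
  · refine IsLeg.congr (isLeg_one i) ?_ (fun _ _ => rfl)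
    intro x
    simp [h1, h2]

theorem prod_legs (A : Fin ℓ → Hilb ℓ →L[ℂ] Hilb ℓ) (P : Fin ℓ → ℕ → Prop) (h : Fin ℓ → ℕ → ℕ)
    (hA : ∀ i, IsLeg i (P i) (h i) (A i)) (L : List (Fin ℓ)) (hL : L.Nodup)
    (ξ : Hilb ℓ) (a : Fin ℓ → ℕ) (b : ℤ) :
    ((∀ i ∈ L, P i (a i)) →
      (L.map A).prod ξ (a, b) = ξ (fun i => if i ∈ L then h i (a i) else a i, b)) ∧
    ((¬ ∀ i ∈ L, P i (a i)) → (L.map A).prod ξ (a, b) = 0) := by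
  induction L generalizing a with
  | nil => simp
  | cons j L ih =>
    rw [List.nodup_cons] at hL
    rw [List.map_cons, List.prod_cons]
    change (_ → A j ((L.map A).prod ξ) (a, b) = _) ∧ (_ → A j ((L.map A).prod ξ) (a, b) = 0)
    have ih' := ih hL.2 (Function.update a j (h j (a j)))
    have e : ∀ i ∈ L, Function.update a j (h j (a j)) i = a i := by
      intro i hi
      rw [Function.update_of_ne]
      rintro rfl
      exact hL.1 hi
    have e2 : (∀ i ∈ L, P i (Function.update a j (h j (a j)) i)) ↔ ∀ i ∈ L, P i (a i) :=
      forall₂_congr fun i hi => by rw [e i hi]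
    rw [e2] at ih'
    have e3 : (fun i => if i ∈ L then h i (Function.update a j (h j (a j)) i)
        else Function.update a j (h j (a j)) i) =
        fun i => if i ∈ j :: L then h i (a i) else a i := by
      funext i
      by_cases hij : i = j
      · subst hij
        simp [hL.1]
      · simp [hij]
    rw [e3] at ih'
    constructor
    · intro h1
      rw [List.forall_mem_cons] at h1
      rw [(hA j _ a b).1 h1.1, ih'.1 h1.2]
    · intro h1
      rw [List.forall_mem_cons] at h1
      by_cases h2 : P j (a j)
      · rw [(hA j _ a b).1 h2, ih'.2 fun h3 => h1 ⟨h2, h3⟩]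
      · exact (hA j _ a b).2 h2

theorem legDom_legMap (k : Fin (ℓ + 1)) (m n : Fin ℓ → ℕ) (i : Fin ℓ) (x : ℕ)
    (h : legDom k m i x) :
    legDom k n i (legMap k m n i x) ∧ legMap k n m i (legMap k m n i x) = x := by
  unfold legDom legMap at *
  split_ifs with h1 h2
  · exact ⟨⟨fun _ => rfl, fun _ => le_rfl⟩, (h.1 h1).symm⟩
  · have := h.2 h2
    exact ⟨⟨fun _ => by omega, fun _ => by omega⟩, by omega⟩
  · exact ⟨⟨fun h3 => absurd h3 h1, fun h3 => absurd h3 h2⟩, rfl⟩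

open Classical in
/-- The partial bijection of the index set `ℕ^ℓ × ℤ` that underlies `opB`. -/
def shiftB (k : Fin (ℓ + 1)) (c : ℤ) (m n : Fin ℓ → ℕ) :
    ((Fin ℓ → ℕ) × ℤ) ≃. ((Fin ℓ → ℕ) × ℤ) where
  toFun x := if ∀ i, legDom k m i (x.1 i) then some (fun i => legMap k m n i (x.1 i), x.2 - c)
    else none
  invFun x := if ∀ i, legDom k n i (x.1 i) then some (fun i => legMap k n m i (x.1 i), x.2 + c)
    else none
  inv := by
    rintro ⟨a, b⟩ ⟨a', b'⟩
    simp only [Option.ite_none_right_eq_some, Option.some.injEq, Prod.mk.injEq]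
    constructor
    · rintro ⟨h, rfl, rfl⟩
      exact ⟨fun i => (legDom_legMap k n m i _ (h i)).1,
        funext fun i => (legDom_legMap k n m i _ (h i)).2, by ring⟩
    · rintro ⟨h, rfl, rfl⟩
      exact ⟨fun i => (legDom_legMap k m n i _ (h i)).1,
        funext fun i => (legDom_legMap k m n i _ (h i)).2, by ring⟩

theorem opB_eq (k : Fin (ℓ + 1)) (r : ℤ) (m n : Fin ℓ → ℕ) :
    opB k r m n = partialShift (shiftB k (expo k r m n) m n) := by
  ext ξ ⟨a, b⟩
  have h := prod_legs (leg k m n) _ _ (isLeg_leg k m n) (List.finRange ℓ)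
    (List.nodup_finRange ℓ) (opT ℓ (expo k r m n) ξ) a b
  simp only [List.mem_finRange, true_imp_iff, if_true] at h
  rw [partialShift_apply]
  change (List.map (leg k m n) (List.finRange ℓ)).prod (opT ℓ (expo k r m n) ξ) (a, b) = _
  by_cases hd : ∀ i, legDom k m i (a i)
  · rw [h.1 hd]
    have : shiftB k (expo k r m n) m n (a, b) =
        some (fun i => legMap k m n i (a i), b - expo k r m n) := if_pos hd
    rw [this]
    rfl
  · rw [h.2 hd]
    have : shiftB k (expo k r m n) m n (a, b) = none := if_neg hd
    rw [this]
    rfl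

theorem expo_swap (k : Fin (ℓ + 1)) (r : ℤ) (m n : Fin ℓ → ℕ) :
    expo k (-r) n m = - expo k r m n := by
  unfold expo
  rw [neg_add, ← Finset.sum_neg_distrib]
  congr 1
  · refine Finset.sum_congr rfl fun i _ => ?_
    split_ifs <;> ring
  · split_ifs <;> ring

theorem star_opB (k : Fin (ℓ + 1)) (r : ℤ) (m n : Fin ℓ → ℕ) :
    star (opB k r m n) = opB k (-r) n m := by
  rw [opB_eq, opB_eq, partialShift_star, expo_swap]
  congr 1
  ext ⟨a, b⟩ : 1
  by_cases h : ∀ i, legDom k n i (a i)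
  · refine Eq.trans (if_pos h) (Eq.trans ?_ (if_pos h).symm)
    rw [sub_neg_eq_add]
  · exact Eq.trans (if_neg h) (if_neg h).symm

/-- The underlying set of `T`. -/
def setT (ℓ : ℕ) : Set (Hilb ℓ →L[ℂ] Hilb ℓ) :=
  {A | A = 0 ∨ ∃ (k : Fin (ℓ + 1)) (r : ℤ) (m n : Fin ℓ → ℕ), A = opB k r m n}

theorem star_mem_setT {A : Hilb ℓ →L[ℂ] Hilb ℓ} (h : A ∈ setT ℓ) : star A ∈ setT ℓ := by
  rcases h with rfl | ⟨k, r, m, n, rfl⟩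
  · exact Or.inl (star_zero _)
  · exact Or.inr ⟨k, -r, n, m, star_opB k r m n⟩

theorem shiftB_trans_apply (k k' : Fin (ℓ + 1)) (c c' : ℤ) (m n m' n' : Fin ℓ → ℕ)
    (a : Fin ℓ → ℕ) (b : ℤ) :
    ((∀ i, legDom k m i (a i) ∧ legDom k' m' i (legMap k m n i (a i))) →
      (shiftB k c m n).trans (shiftB k' c' m' n') (a, b) =
        some (fun i => legMap k' m' n' i (legMap k m n i (a i)), b - c - c')) ∧
    ((¬ ∀ i, legDom k m i (a i) ∧ legDom k' m' i (legMap k m n i (a i))) →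
      (shiftB k c m n).trans (shiftB k' c' m' n') (a, b) = none) := by
  change (_ → (shiftB k c m n (a, b)).bind _ = _) ∧ (_ → (shiftB k c m n (a, b)).bind _ = _)
  have e : ∀ (k : Fin (ℓ + 1)) (c : ℤ) (m n : Fin ℓ → ℕ) (a : Fin ℓ → ℕ) (b : ℤ),
    ((∀ i, legDom k m i (a i)) → shiftB k c m n (a, b) =
      some (fun i => legMap k m n i (a i), b - c)) ∧
    ((¬ ∀ i, legDom k m i (a i)) → shiftB k c m n (a, b) = none) :=
    fun k c m n a b => ⟨fun h => if_pos h, fun h => if_neg h⟩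
  constructor
  · intro h
    rw [(e k c m n a b).1 fun i => (h i).1]
    exact (e k' c' m' n' _ _).1 fun i => (h i).2
  · intro h
    by_cases h1 : ∀ i, legDom k m i (a i)
    · rw [(e k c m n a b).1 h1]
      exact (e k' c' m' n' _ _).2 fun h2 => h fun i => ⟨h1 i, h2 i⟩
    · rw [(e k c m n a b).2 h1]
      rfl

/-- A criterion for a product of two of the operators to be a third one. -/
theorem opB_mul_eq {k k' k'' : Fin (ℓ + 1)} {r r' r'' : ℤ} {m n m' n' m'' n'' : Fin ℓ → ℕ}
    (hd : ∀ i x, legDom k m i x ∧ legDom k' m' i (legMap k m n i x) ↔ legDom k'' m'' i x)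
    (hm : ∀ i x, legDom k'' m'' i x →
      legMap k' m' n' i (legMap k m n i x) = legMap k'' m'' n'' i x)
    (he : expo k r m n + expo k' r' m' n' = expo k'' r'' m'' n'') :
    opB k r m n * opB k' r' m' n' = opB k'' r'' m'' n'' := by
  rw [opB_eq, opB_eq, opB_eq, partialShift_mul]
  congr 1
  ext ⟨a, b⟩ : 1
  have h := shiftB_trans_apply k k' (expo k r m n) (expo k' r' m' n') m n m' n' a b
  simp only [hd] at h
  by_cases h1 : ∀ i, legDom k'' m'' i (a i)
  · rw [h.1 h1, sub_sub, he]
    refine Eq.trans ?_ (if_pos h1).symm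
    congr 2
    funext i
    exact hm i _ (h1 i)
  · rw [h.2 h1]
    exact (if_neg h1).symm

theorem opB_mul_eq_zero {k k' : Fin (ℓ + 1)} {r r' : ℤ} {m n m' n' : Fin ℓ → ℕ} (i : Fin ℓ)
    (hd : ∀ x, legDom k m i x → ¬ legDom k' m' i (legMap k m n i x)) :
    opB k r m n * opB k' r' m' n' = 0 := by
  rw [opB_eq, opB_eq, partialShift_mul, ← partialShift_bot]
  congr 1
  ext ⟨a, b⟩ : 1
  exact (shiftB_trans_apply k k' (expo k r m n) (expo k' r' m' n') m n m' n' a b).2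
    fun h => hd _ (h i).1 (h i).2

theorem opB_mul_of_lt {k k' : Fin (ℓ + 1)} (hk : k.1 < k'.1) {r r' : ℤ} {m n m' n' : Fin ℓ → ℕ}
    (h : ∀ i : Fin ℓ, (i.1 < k.1 → n i = m' i) ∧ (i.1 = k.1 → n i ≤ m' i)) :
    opB k r m n * opB k' r' m' n' =
      opB k' r' (fun i => if i.1 < k.1 then m i else if i.1 = k.1 then m i + m' i - n i else m' i)
        n' := by
  refine opB_mul_eq ?_ ?_ ?_
  · intro i x
    have := h i
    unfold legDom legMap
    rcases lt_trichotomy i.1 k.1 with h1 | h1 | h1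
    · have e1 : i.1 ≠ k.1 := by omega
      have e2 : i.1 < k'.1 := by omega
      have e3 : i.1 ≠ k'.1 := by omega
      simp [h1, e1, e2, e3, this]
    · have := this.2 h1
      simp only [h1, hk, hk.ne, if_true, if_false, false_imp_iff, true_imp_iff, true_and,
        and_true, lt_irrefl]
      omega
    · have e1 : ¬ i.1 < k.1 := by omega
      have e2 : ¬ i.1 = k.1 := by omega
      simp [e1, e2]
  · intro i x hx
    unfold legDom at hx
    unfold legMap
    rcases lt_trichotomy i.1 k.1 with h1 | h1 | h1
    · have e2 : i.1 < k'.1 := by omega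
      simp [e2]
    · have e2 : i.1 < k'.1 := by omega
      simp [e2]
    · have e1 : ¬ i.1 < k.1 := by omega
      have e2 : ¬ i.1 = k.1 := by omega
      simp [e1, e2]
  · unfold expo
    have e1 : k.1 ≠ ℓ := by omega
    rw [if_neg e1, add_zero, ← add_assoc, ← Finset.sum_add_distrib]
    congr 1
    refine Finset.sum_congr rfl fun i _ => ?_
    have := h i
    dsimp only
    split_ifs <;> omega

theorem opB_mul_self {k : Fin (ℓ + 1)} {r r' : ℤ} {m n m' n' : Fin ℓ → ℕ}
    (h : ∀ i : Fin ℓ, i.1 < k.1 → n i = m' i) :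
    opB k r m n * opB k r' m' n' =
      opB k (r + r') (fun i => if i.1 < k.1 then m i else m i + (m' i - n i))
        (fun i => if i.1 < k.1 then n' i else n' i + (n i - m' i)) := by
  refine opB_mul_eq ?_ ?_ ?_
  · intro i x
    have := h i
    unfold legDom legMap
    rcases lt_trichotomy i.1 k.1 with h1 | h1 | h1
    · have e1 : i.1 ≠ k.1 := by omega
      simp [h1, e1, this]
    · simp only [h1, if_true, if_false, false_imp_iff, true_imp_iff, true_and,
        lt_irrefl]
      omega
    · have e1 : ¬ i.1 < k.1 := by omega
      have e2 : ¬ i.1 = k.1 := by omega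
      simp [e1, e2]
  · intro i x hx
    unfold legDom at hx
    unfold legMap
    rcases lt_trichotomy i.1 k.1 with h1 | h1 | h1
    · simp [h1]
    · simp only [h1, if_true, if_false, false_imp_iff, true_imp_iff, true_and,
        lt_irrefl] at hx ⊢
      omega
    · have e1 : ¬ i.1 < k.1 := by omega
      have e2 : ¬ i.1 = k.1 := by omega
      simp [e1, e2]
  · unfold expo
    rw [add_add_add_comm, ← Finset.sum_add_distrib]
    congr 1
    · refine Finset.sum_congr rfl fun i _ => ?_
      have := h i
      dsimp only
      split_ifs <;> omega
    · split_ifs <;> simp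

theorem mul_mem_setT {A C : Hilb ℓ →L[ℂ] Hilb ℓ} (hA : A ∈ setT ℓ) (hC : C ∈ setT ℓ) :
    A * C ∈ setT ℓ := by
  have key : ∀ (k k' : Fin (ℓ + 1)) (r r' : ℤ) (m n m' n' : Fin ℓ → ℕ), k.1 ≤ k'.1 →
      opB k r m n * opB k' r' m' n' ∈ setT ℓ := by
    intro k k' r r' m n m' n' hk
    by_cases h1 : ∃ i : Fin ℓ, i.1 < k.1 ∧ n i ≠ m' i
    · obtain ⟨i, hi, hne⟩ := h1
      left
      refine opB_mul_eq_zero i fun x _ h => ?_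
      unfold legDom legMap at h
      rw [if_pos hi] at h
      exact hne (h.1 (by omega))
    · push Not at h1
      rcases hk.lt_or_eq with hk | hk
      · by_cases h2 : ∃ i : Fin ℓ, i.1 = k.1 ∧ m' i < n i
        · obtain ⟨i, hi, hlt⟩ := h2
          left
          refine opB_mul_eq_zero i fun x _ h => ?_
          unfold legDom legMap at h
          rw [if_neg (by omega), if_pos hi] at h
          have := h.1 (by omega)
          omega
        · push Not at h2
          exact Or.inr ⟨_, _, _, _, opB_mul_of_lt hk fun i => ⟨h1 i, h2 i⟩⟩
      · obtain rfl : k = k' := Fin.ext hk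
        exact Or.inr ⟨_, _, _, _, opB_mul_self h1⟩
  rcases hA with rfl | ⟨k, r, m, n, rfl⟩
  · exact Or.inl (zero_mul _)
  rcases hC with rfl | ⟨k', r', m', n', rfl⟩
  · exact Or.inl (mul_zero _)
  rcases le_total k.1 k'.1 with h | h
  · exact key _ _ _ _ _ _ _ _ h
  · have := star_mem_setT (key k' k (-r') (-r) n' m' n m h)
    rwa [star_mul, star_opB, star_opB, neg_neg, neg_neg] at this

theorem exists_shift_of_mem {A : Hilb ℓ →L[ℂ] Hilb ℓ} (hA : A ∈ setT ℓ) :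
    ∃ f, A = partialShift f := by
  rcases hA with rfl | ⟨k, r, m, n, rfl⟩
  · exact ⟨⊥, partialShift_bot.symm⟩
  · exact ⟨_, opB_eq k r m n⟩

/-- The inverse semigroup `T` of partial isometries, with operator product and adjoint. -/
def InvT (ℓ : ℕ) : Type := {A : Hilb ℓ →L[ℂ] Hilb ℓ // A ∈ setT ℓ}

theorem pequiv_symm_unique {ι : Type*} (f g : ι ≃. ι) (h1 : (f.trans g).trans f = f)
    (h2 : (g.trans f).trans g = g) : g = f.symm := by
  have key : ∀ f g : ι ≃. ι, (f.trans g).trans f = f → ∀ a b, f a = some b → g b = some a := by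
    intro f g h a b hab
    have h3 : (f.trans g).trans f a = some b := by rw [h, hab]
    rw [PEquiv.trans_eq_some] at h3
    obtain ⟨c, hc, hcb⟩ := h3
    rw [PEquiv.trans_eq_some] at hc
    obtain ⟨d, hd, hdc⟩ := hc
    have e1 : d = b := by
      rw [hab] at hd
      exact (Option.some.inj hd).symm
    have e2 : c = a := f.inj hcb hab
    rw [← e1, ← e2]
    exact hdc
  ext b a
  constructor
  · intro h
    exact f.eq_some_iff.2 (key g f h2 b a h)
  · intro h
    exact key f g h1 a b (f.eq_some_iff.1 h)

theorem pequiv_mul_symm_mul {ι : Type*} (f : ι ≃. ι) : (f.trans f.symm).trans f = f := by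
  classical
  ext a b
  rw [PEquiv.trans_eq_some]
  constructor
  · rintro ⟨c, hc, hcb⟩
    rw [PEquiv.trans_eq_some] at hc
    obtain ⟨d, hd, hdc⟩ := hc
    have := f.eq_some_iff.1 hdc
    rw [hcb] at this
    rw [hd, this]
  · intro h
    refine ⟨a, ?_, h⟩
    rw [PEquiv.trans_eq_some]
    exact ⟨b, h, f.eq_some_iff.2 h⟩

instance : InverseSemigroup₀ (InvT ℓ) where
  mul A C := ⟨A.1 * C.1, mul_mem_setT A.2 C.2⟩
  mul_assoc A C D := Subtype.ext (mul_assoc A.1 C.1 D.1)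
  zero := ⟨0, Or.inl rfl⟩
  zero_mul A := Subtype.ext (zero_mul A.1)
  mul_zero A := Subtype.ext (mul_zero A.1)
  star A := ⟨star A.1, star_mem_setT A.2⟩
  mul_star_mul A := Subtype.ext (by
    change A.1 * star A.1 * A.1 = A.1
    obtain ⟨f, hf⟩ := exists_shift_of_mem A.2
    rw [hf, partialShift_star, partialShift_mul, partialShift_mul, pequiv_mul_symm_mul])
  star_mul_star A := Subtype.ext (by
    change star A.1 * A.1 * star A.1 = star A.1
    obtain ⟨f, hf⟩ := exists_shift_of_mem A.2
    rw [hf, partialShift_star, partialShift_mul, partialShift_mul]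
    congr 1
    exact pequiv_mul_symm_mul f.symm)
  star_unique A C h1 h2 := Subtype.ext (by
    change C.1 = star A.1
    have h1' : A.1 * C.1 * A.1 = A.1 := congrArg Subtype.val h1
    have h2' : C.1 * A.1 * C.1 = C.1 := congrArg Subtype.val h2
    obtain ⟨f, hf⟩ := exists_shift_of_mem A.2
    obtain ⟨g, hg⟩ := exists_shift_of_mem C.2
    rw [hf, hg, partialShift_mul, partialShift_mul] at h1' h2'
    rw [hf, hg, partialShift_star]
    congr 1
    exact pequiv_symm_unique f g (partialShift_injective h1') (partialShift_injective h2'))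

/-- The element `B_{k+1}(r, m, n)` of `T`. -/
def elemB (k : Fin (ℓ + 1)) (r : ℤ) (m n : Fin ℓ → ℕ) : InvT ℓ :=
  ⟨opB k r m n, Or.inr ⟨k, r, m, n, rfl⟩⟩

theorem elemB_mul_star (k : Fin (ℓ + 1)) (r : ℤ) (m n : Fin ℓ → ℕ) :
    elemB k r m n * star (elemB k r m n) = elemB k 0 m m := by
  apply Subtype.ext
  change opB k r m n * star (opB k r m n) = opB k 0 m m
  rw [star_opB, opB_mul_self fun _ _ => rfl]
  simp

theorem star_elemB (k : Fin (ℓ + 1)) (m : Fin ℓ → ℕ) :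
    star (elemB k 0 m m) = elemB k 0 m m := by
  apply Subtype.ext
  change star (opB k 0 m m) = opB k 0 m m
  rw [star_opB, neg_zero]

/-- The projection `p_{k+1}(m) = B_{k+1}(0, m, m)`. -/
def projB (k : Fin (ℓ + 1)) (m : Fin ℓ → ℕ) : InverseSemigroup₀.Proj (InvT ℓ) :=
  ⟨elemB k 0 m m, star_elemB k m, by
    have := elemB_mul_star k 0 m m
    rwa [star_elemB] at this⟩

theorem projB_ne_zero (k : Fin (ℓ + 1)) (m : Fin ℓ → ℕ) : projB k m ≠ 0 := by
  intro h
  have h1 : opB k 0 m m = 0 := congrArg (fun e => e.1.1) h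
  rw [opB_eq, ← partialShift_bot] at h1
  have h2 := congrArg (fun f => f (m, (0 : ℤ))) (partialShift_injective h1)
  have h3 : shiftB k (expo k 0 m m) m m (m, (0 : ℤ)) = some _ :=
    if_pos fun i => ⟨fun _ => rfl, fun _ => le_rfl⟩
  simp only [h3] at h2
  exact Option.some_ne_none _ h2

theorem projB_mul_projB {k : Fin (ℓ + 1)} {m m' : Fin ℓ → ℕ}
    (h : ∀ i : Fin ℓ, i.1 < k.1 → m i = m' i) (h' : ∀ i : Fin ℓ, m' i ≤ m i) :
    projB k m * projB k m' = projB k m := by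
  apply Subtype.ext
  apply Subtype.ext
  change opB k 0 m m * opB k 0 m' m' = opB k 0 m m
  rw [opB_mul_self h, add_zero]
  congr 1
  · funext i
    have := h' i
    split_ifs <;> omega
  · funext i
    have := h' i
    split_ifs with hi
    · exact (h i hi).symm
    · omega

/-! ## The characters `φ(w)` -/

theorem exists_firstTop (w : Fin ℓ → ℕ∞) : ∃ r, ∀ h : r < ℓ, w ⟨r, h⟩ = ⊤ :=
  ⟨ℓ, fun h => absurd h (lt_irrefl ℓ)⟩

open Classical in
/-- The least `r` such that the coordinate `w_{r+1}` of `w` is `∞`, where `w_{ℓ+1} = ∞`; with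
coordinates numbered from `0`, this is the position of the first infinite one. -/
def firstTop (w : Fin ℓ → ℕ∞) : Fin (ℓ + 1) :=
  ⟨Nat.find (exists_firstTop w),
    Nat.lt_succ_of_le (Nat.find_min' _ fun h => absurd h (lt_irrefl ℓ))⟩

theorem ne_top_of_lt_firstTop {w : Fin ℓ → ℕ∞} {i : Fin ℓ} (h : i.1 < (firstTop w).1) :
    w i ≠ ⊤ := by
  classical
  intro hi
  exact Nat.find_min (exists_firstTop w) h fun _ => hi

/-- Membership in the filter generated by `Λ_w = {p_{r+1}(w_1, …, w_r, n)}`: `f ≥ e`, that is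
`e f = e`, for some `e` in `Λ_w`. -/
def InFilter (w : Fin ℓ → ℕ∞) (f : InverseSemigroup₀.Proj (InvT ℓ)) : Prop :=
  ∃ m : Fin ℓ → ℕ, (∀ i : Fin ℓ, i.1 < (firstTop w).1 → (m i : ℕ∞) = w i) ∧
    projB (firstTop w) m * f = projB (firstTop w) m

theorem proj_mul_assoc (e f g : InverseSemigroup₀.Proj (InvT ℓ)) : e * f * g = e * (f * g) :=
  Subtype.ext (mul_assoc e.1 f.1 g.1)

theorem proj_mul_self (e : InverseSemigroup₀.Proj (InvT ℓ)) : e * e = e := Subtype.ext e.2.2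

theorem proj_mul_comm (e f : InverseSemigroup₀.Proj (InvT ℓ)) : e * f = f * e :=
  Subtype.ext (InverseSemigroup₀.proj_comm e f)

theorem inFilter_mul {w : Fin ℓ → ℕ∞} {e f : InverseSemigroup₀.Proj (InvT ℓ)} :
    InFilter w (e * f) ↔ InFilter w e ∧ InFilter w f := by
  constructor
  · rintro ⟨m, hm, h⟩
    refine ⟨⟨m, hm, ?_⟩, ⟨m, hm, ?_⟩⟩
    · nth_rewrite 1 [← h]
      rw [proj_mul_assoc, proj_mul_assoc, proj_mul_comm f e, ← proj_mul_assoc e, proj_mul_self, h]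
    · nth_rewrite 1 [← h]
      rw [proj_mul_assoc, proj_mul_assoc, proj_mul_self, h]
  · rintro ⟨⟨m, hm, h⟩, ⟨n, hn, h'⟩⟩
    have hmn : ∀ i : Fin ℓ, i.1 < (firstTop w).1 → m i = n i := by
      intro i hi
      have := (hm i hi).trans (hn i hi).symm
      exact_mod_cast this
    have h1 : projB (firstTop w) (fun i => max (m i) (n i)) * projB (firstTop w) m =
        projB (firstTop w) (fun i => max (m i) (n i)) := by
      refine projB_mul_projB (fun i hi => ?_) fun i => le_max_left _ _
      simp [hmn i hi]
    have h2 : projB (firstTop w) (fun i => max (m i) (n i)) * projB (firstTop w) n =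
        projB (firstTop w) (fun i => max (m i) (n i)) := by
      refine projB_mul_projB (fun i hi => ?_) fun i => le_max_right _ _
      simp [hmn i hi]
    refine ⟨fun i => max (m i) (n i), fun i hi => ?_, ?_⟩
    · simp [← hmn i hi, hm i hi]
    · generalize projB (firstTop w) (fun i => max (m i) (n i)) = q at h1 h2 ⊢
      have h3 : q * e = q := by
        nth_rewrite 1 [← h1]
        rw [proj_mul_assoc, h, h1]
      have h4 : q * f = q := by
        nth_rewrite 1 [← h2]
        rw [proj_mul_assoc, h', h2]
      rw [← proj_mul_assoc, h3, h4]

theorem not_inFilter_zero (w : Fin ℓ → ℕ∞) : ¬ InFilter w 0 := by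
  rintro ⟨m, _, h⟩
  have h0 : projB (firstTop w) m * 0 = 0 := Subtype.ext (mul_zero (projB (firstTop w) m).1)
  exact projB_ne_zero _ m (h.symm.trans h0)

theorem inFilter_projB {w : Fin ℓ → ℕ∞} {m : Fin ℓ → ℕ}
    (hm : ∀ i : Fin ℓ, i.1 < (firstTop w).1 → (m i : ℕ∞) = w i) :
    InFilter w (projB (firstTop w) m) :=
  ⟨m, hm, proj_mul_self _⟩

open Classical in
/-- The character `φ(w)`: the indicator function of the filter generated by `Λ_w`. -/
def phi (w : Fin ℓ → ℕ∞) : InverseSemigroup₀.Character (InvT ℓ) :=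
  ⟨fun f => decide (InFilter w f),
    fun e f => by
      rw [Bool.eq_iff_iff]
      simp [inFilter_mul],
    by simp [not_inFilter_zero],
    ⟨projB (firstTop w) fun i => (w i).toNat, by
      simp only [decide_eq_true_eq]
      exact inFilter_projB fun i hi => ENat.natCast_toNat (ne_top_of_lt_firstTop hi)⟩⟩

/-! ## Sheu's groupoid -/

/-- The translate `x + w` of `w ∈ ℕ ∪ {∞}` by an integer `x`, where `x + ∞ = ∞`; it is used
only if `w = ∞` or `0 ≤ x + w`. -/
def translate (x : ℤ) (w : ℕ∞) : ℕ∞ := if w = ⊤ then ⊤ else ((x + w.toNat).toNat : ℕ∞)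

variable (ℓ) in
/-- The groupoid `Σ` of triples `(z, x, w)` in `ℤ × ℤ^ℓ × (ℕ ∪ {∞})^ℓ` with
`x + w ∈ (ℕ ∪ {∞})^ℓ` such that `w_i = ∞` implies `x_{i+1} = ⋯ = x_ℓ = 0` and
`z = - ∑_{j ≤ i} x_j`. It carries the subspace topology (and `ℕ ∪ {∞}` the topology of the
one point compactification). -/
abbrev SheuSigma : Type :=
  {a : ℤ × (Fin ℓ → ℤ) × (Fin ℓ → ℕ∞) //
    (∀ i, a.2.2 i ≠ ⊤ → 0 ≤ a.2.1 i + (a.2.2 i).toNat) ∧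
    ∀ i, a.2.2 i = ⊤ → (∀ j, i < j → a.2.1 j = 0) ∧ a.1 = -∑ j ∈ Finset.Iic i, a.2.1 j}

open Classical in
/-- Replace all coordinates after the first infinite one by `∞`. -/
def trunc (w : Fin ℓ → ℕ∞) : Fin ℓ → ℕ∞ := fun i => if ∃ j < i, w j = ⊤ then ⊤ else w i

variable (ℓ) in
/-- The equivalence relation on `Σ` generated by
`(z, x, w_1, …, w_{i-1}, ∞, …) ∼ (z, x, w_1, …, w_{i-1}, ∞, ∞, …, ∞)`. -/
def sheuSetoid : Setoid (SheuSigma ℓ) where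
  r a b := a.1.1 = b.1.1 ∧ a.1.2.1 = b.1.2.1 ∧ trunc a.1.2.2 = trunc b.1.2.2
  iseqv :=
    { refl := fun _ => ⟨rfl, rfl, rfl⟩
      symm := fun h => ⟨h.1.symm, h.2.1.symm, h.2.2.symm⟩
      trans := fun h k => ⟨h.1.trans k.1, h.2.1.trans k.2.1, h.2.2.trans k.2.2⟩ }

variable (ℓ) in
/-- Sheu's groupoid `Σ/∼`. -/
def SheuGroupoid : Type := Quotient (sheuSetoid ℓ)

/-- The class of an element of `Σ`. -/
def SheuGroupoid.mk (a : SheuSigma ℓ) : SheuGroupoid ℓ := Quotient.mk (sheuSetoid ℓ) a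

/-- The quotient topology. -/
instance : TopologicalSpace (SheuGroupoid ℓ) :=
  inferInstanceAs (TopologicalSpace (Quotient (sheuSetoid ℓ)))

/-- The source `x + w` of `(z, x, w)`, whose range is `w`. -/
def sheuSrc (a : SheuSigma ℓ) : Fin ℓ → ℕ∞ := fun i => translate (a.1.2.1 i) (a.1.2.2 i)

theorem translate_eq_top {x : ℤ} {w : ℕ∞} : translate x w = ⊤ ↔ w = ⊤ := by
  unfold translate
  split_ifs with h <;> simp [h]

theorem translate_translate {x y : ℤ} {w : ℕ∞} (h : w ≠ ⊤ → 0 ≤ x + w.toNat) :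
    translate y (translate x w) = translate (x + y) w := by
  by_cases hw : w = ⊤
  · simp [translate, hw]
  · have := h hw
    simp only [translate, hw, if_false, ENat.natCast_ne_top, ENat.toNat_natCast]
    congr 1
    omega

theorem translate_neg {x : ℤ} {w : ℕ∞} (h : w ≠ ⊤ → 0 ≤ x + w.toNat) :
    translate (-x) (translate x w) = w := by
  rw [translate_translate h, add_neg_cancel]
  by_cases hw : w = ⊤
  · simp [translate, hw]
  · simp [translate, hw]

theorem trunc_translate (x : Fin ℓ → ℤ) (w : Fin ℓ → ℕ∞) :
    trunc (fun i => translate (x i) (w i)) = fun i => translate (x i) (trunc w i) := by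
  classical
  funext i
  unfold trunc
  simp only [translate_eq_top]
  split_ifs
  · simp [translate]
  · rfl

theorem trunc_sheuSrc_congr {a b : SheuSigma ℓ} (h : (sheuSetoid ℓ) a b) :
    trunc (sheuSrc a) = trunc (sheuSrc b) := by
  unfold sheuSrc
  rw [trunc_translate, trunc_translate, h.2.1, h.2.2]

theorem exists_top_of_trunc_eq {u v : Fin ℓ → ℕ∞} (h : trunc u = trunc v) {i : Fin ℓ}
    (hi : u i = ⊤) : ∃ j ≤ i, v j = ⊤ := by
  classical
  have h1 : trunc u i = ⊤ := by
    unfold trunc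
    split_ifs <;> simp [hi]
  rw [h] at h1
  unfold trunc at h1
  split_ifs at h1 with h2
  · obtain ⟨j, hj, hv⟩ := h2
    exact ⟨j, hj.le, hv⟩
  · exact ⟨i, le_rfl, h1⟩

theorem eq_of_trunc_eq {u v : Fin ℓ → ℕ∞} (h : trunc u = trunc v) {i : Fin ℓ}
    (hi : ¬ ∃ j ≤ i, u j = ⊤) : v i = u i := by
  classical
  have h1 := congrFun h i
  unfold trunc at h1
  have h2 : ¬ ∃ j < i, u j = ⊤ := fun ⟨j, hj, hu⟩ => hi ⟨j, hj.le, hu⟩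
  rw [if_neg h2] at h1
  split_ifs at h1 with h3
  · exact absurd ⟨i, le_rfl, h1⟩ hi
  · exact h1.symm

/-- The conditions defining `Σ` extend to the sum over a longer interval. -/
theorem sheu_top {a : SheuSigma ℓ} {i j : Fin ℓ} (hj : j ≤ i) (h : a.1.2.2 j = ⊤) :
    (∀ l, i < l → a.1.2.1 l = 0) ∧ a.1.1 = -∑ l ∈ Finset.Iic i, a.1.2.1 l := by
  obtain ⟨h1, h2⟩ := a.2.2 j h
  refine ⟨fun l hl => h1 l (hj.trans_lt hl), ?_⟩
  rw [h2]
  congr 1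
  refine Finset.sum_subset (Finset.Iic_subset_Iic.2 hj) fun l _ hl => h1 l ?_
  simpa using hl

theorem sheu_mul_mem {a b : SheuSigma ℓ} (h : trunc (sheuSrc a) = trunc b.1.2.2) :
    (∀ i, a.1.2.2 i ≠ ⊤ → 0 ≤ (a.1.2.1 + b.1.2.1) i + (a.1.2.2 i).toNat) ∧
    ∀ i, a.1.2.2 i = ⊤ → (∀ j, i < j → (a.1.2.1 + b.1.2.1) j = 0) ∧
      a.1.1 + b.1.1 = -∑ j ∈ Finset.Iic i, (a.1.2.1 + b.1.2.1) j := by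
  constructor
  · intro i hi
    have h0 := a.2.1 i hi
    rw [Pi.add_apply]
    by_cases h1 : ∃ j ≤ i, sheuSrc a j = ⊤
    · obtain ⟨j, hj, hu⟩ := h1
      have hji : j < i := by
        refine lt_of_le_of_ne hj ?_
        rintro rfl
        exact hi (translate_eq_top.1 hu)
      obtain ⟨l, hl, hv⟩ := exists_top_of_trunc_eq h hu
      rw [(b.2.2 l hv).1 i (hl.trans_lt hji), add_zero]
      exact h0
    · have h2 := eq_of_trunc_eq h h1
      have h3 : sheuSrc a i = (((a.1.2.1 i + (a.1.2.2 i).toNat).toNat : ℕ) : ℕ∞) := if_neg hi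
      rw [h3] at h2
      have h4 := b.2.1 i (by rw [h2]; exact ENat.natCast_ne_top _)
      rw [h2, ENat.toNat_natCast] at h4
      omega
  · intro i hi
    have hu : sheuSrc a i = ⊤ := translate_eq_top.2 hi
    obtain ⟨l, hl, hv⟩ := exists_top_of_trunc_eq h hu
    obtain ⟨h1, h2⟩ := sheu_top hl hv
    obtain ⟨h3, h4⟩ := a.2.2 i hi
    refine ⟨fun j hj => by rw [Pi.add_apply, h1 j hj, h3 j hj, add_zero], ?_⟩
    simp only [Pi.add_apply]
    rw [Finset.sum_add_distrib, h2, h4]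
    ring

theorem sheu_inv_mem (a : SheuSigma ℓ) :
    (∀ i, sheuSrc a i ≠ ⊤ → 0 ≤ (-a.1.2.1) i + (sheuSrc a i).toNat) ∧
    ∀ i, sheuSrc a i = ⊤ → (∀ j, i < j → (-a.1.2.1) j = 0) ∧
      -a.1.1 = -∑ j ∈ Finset.Iic i, (-a.1.2.1) j := by
  constructor
  · intro i hi
    have hi' : a.1.2.2 i ≠ ⊤ := fun h => hi (translate_eq_top.2 h)
    have h3 : sheuSrc a i = (((a.1.2.1 i + (a.1.2.2 i).toNat).toNat : ℕ) : ℕ∞) := if_neg hi'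
    have := a.2.1 i hi'
    rw [h3, ENat.toNat_natCast, Pi.neg_apply]
    omega
  · intro i hi
    obtain ⟨h1, h2⟩ := a.2.2 i (translate_eq_top.1 hi)
    refine ⟨fun j hj => by rw [Pi.neg_apply, h1 j hj, neg_zero], ?_⟩
    simp only [Pi.neg_apply]
    rw [Finset.sum_neg_distrib, h2]

/-- The triple `(z + z', x + x', w)`. -/
def sigmaMul (a b : SheuSigma ℓ) (h : trunc (sheuSrc a) = trunc b.1.2.2) : SheuSigma ℓ :=
  ⟨(a.1.1 + b.1.1, a.1.2.1 + b.1.2.1, a.1.2.2), sheu_mul_mem h⟩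

/-- The inverse `(-z, -x, x + w)` of `(z, x, w)`. -/
def sigmaInv (a : SheuSigma ℓ) : SheuSigma ℓ :=
  ⟨(-a.1.1, -a.1.2.1, sheuSrc a), sheu_inv_mem a⟩

open Classical in
/-- The product induced on `Σ/∼` by `(z, x, w) (z', x', w') = (z + z', x + x', w)` for
`w' = x + w`: two classes are composable if and only if they have representatives with
`w' = x + w`, which means that `w'` and `x + w` agree up to the first infinite coordinate. -/
def sheuMul (g h : SheuGroupoid ℓ) : Option (SheuGroupoid ℓ) :=
  Quotient.liftOn₂ g h
    (fun a b => if hab : trunc (sheuSrc a) = trunc b.1.2.2 then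
      some (Quotient.mk (sheuSetoid ℓ) (sigmaMul a b hab)) else none)
    (by
      intro a b a' b' ha hb
      have e : (trunc (sheuSrc a) = trunc b.1.2.2) = (trunc (sheuSrc a') = trunc b'.1.2.2) := by
        rw [trunc_sheuSrc_congr ha, hb.2.2]
      by_cases h : trunc (sheuSrc a) = trunc b.1.2.2
      · have h' : trunc (sheuSrc a') = trunc b'.1.2.2 := e ▸ h
        rw [dif_pos h, dif_pos h']
        refine congrArg some (Quotient.sound ⟨?_, ?_, ha.2.2⟩)
        · change a.1.1 + b.1.1 = a'.1.1 + b'.1.1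
          rw [ha.1, hb.1]
        · change a.1.2.1 + b.1.2.1 = a'.1.2.1 + b'.1.2.1
          rw [ha.2.1, hb.2.1]
      · have h' : ¬ trunc (sheuSrc a') = trunc b'.1.2.2 := e ▸ h
        rw [dif_neg h, dif_neg h'])

/-- The inversion induced on `Σ/∼`. -/
def sheuInv (g : SheuGroupoid ℓ) : SheuGroupoid ℓ :=
  Quotient.map sigmaInv (fun a b h => ⟨by
      change -a.1.1 = -b.1.1
      rw [h.1], by
      change -a.1.2.1 = -b.1.2.1
      rw [h.2.1], trunc_sheuSrc_congr h⟩) g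

theorem sheuMul_eq_some {a b : SheuSigma ℓ} (h : trunc (sheuSrc a) = trunc b.1.2.2) :
    sheuMul (Quotient.mk (sheuSetoid ℓ) a) (Quotient.mk (sheuSetoid ℓ) b) =
      some (Quotient.mk (sheuSetoid ℓ) (sigmaMul a b h)) := dif_pos h

theorem sheuMul_eq_some_iff {a b : SheuSigma ℓ} {c : SheuGroupoid ℓ} :
    sheuMul (Quotient.mk (sheuSetoid ℓ) a) (Quotient.mk (sheuSetoid ℓ) b) = some c ↔
      ∃ h : trunc (sheuSrc a) = trunc b.1.2.2,
        c = Quotient.mk (sheuSetoid ℓ) (sigmaMul a b h) := by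
  by_cases h : trunc (sheuSrc a) = trunc b.1.2.2
  · rw [sheuMul_eq_some h]
    constructor
    · intro k
      exact ⟨h, (Option.some.inj k).symm⟩
    · rintro ⟨_, rfl⟩
      rfl
  · have : sheuMul (Quotient.mk (sheuSetoid ℓ) a) (Quotient.mk (sheuSetoid ℓ) b) = none :=
      dif_neg h
    rw [this]
    simp [h]

theorem sheuSrc_inv (a : SheuSigma ℓ) : sheuSrc (sigmaInv a) = a.1.2.2 :=
  funext fun i => translate_neg (a.2.1 i)

theorem trunc_sheuSrc_mul {a b : SheuSigma ℓ} (h : trunc (sheuSrc a) = trunc b.1.2.2) :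
    trunc (sheuSrc (sigmaMul a b h)) = trunc (sheuSrc b) := by
  have e : sheuSrc (sigmaMul a b h) = fun i => translate (b.1.2.1 i) (sheuSrc a i) :=
    funext fun i => (translate_translate (a.2.1 i)).symm
  rw [e, trunc_translate, h, ← trunc_translate]
  rfl

instance : ArrowGroupoid (SheuGroupoid ℓ) where
  pmul := sheuMul
  inv := sheuInv
  inv_inv := by
    rintro ⟨a⟩
    refine congrArg (Quotient.mk (sheuSetoid ℓ)) (Subtype.ext (Prod.ext (neg_neg _)
      (Prod.ext (neg_neg _) (sheuSrc_inv a))))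
  assoc := by
    rintro ⟨a⟩ ⟨b⟩ ⟨c⟩ u v h1 h2
    obtain ⟨k1, rfl⟩ := sheuMul_eq_some_iff.1 h1
    obtain ⟨k2, rfl⟩ := sheuMul_eq_some_iff.1 h2
    refine ⟨_, sheuMul_eq_some (a := sigmaMul a b k1) ((trunc_sheuSrc_mul k1).trans k2), ?_⟩
    refine (sheuMul_eq_some (a := a) (b := sigmaMul b c k2) k1).trans ?_
    refine congrArg some (congrArg _ (Subtype.ext (Prod.ext (add_assoc _ _ _).symm
      (Prod.ext (add_assoc _ _ _).symm rfl))))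
  inv_comp := by
    rintro ⟨a⟩
    exact ⟨_, sheuMul_eq_some (a := sigmaInv a) (congrArg trunc (sheuSrc_inv a))⟩
  comp_inv := by
    rintro ⟨a⟩
    exact ⟨_, sheuMul_eq_some (b := sigmaInv a) rfl⟩
  inv_mul_cancel := by
    rintro ⟨a⟩ ⟨b⟩ c h
    obtain ⟨k, rfl⟩ := sheuMul_eq_some_iff.1 h
    refine (sheuMul_eq_some (a := sigmaInv a) (b := sigmaMul a b k)
      (congrArg trunc (sheuSrc_inv a))).trans ?_
    exact congrArg some (Quotient.sound ⟨neg_add_cancel_left _ _, neg_add_cancel_left _ _, k⟩)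
  mul_inv_cancel := by
    rintro ⟨a⟩ ⟨b⟩ c h
    obtain ⟨k, rfl⟩ := sheuMul_eq_some_iff.1 h
    refine (sheuMul_eq_some (a := sigmaMul a b k) (b := sigmaInv b)
      (trunc_sheuSrc_mul k)).trans ?_
    exact congrArg some (Quotient.sound ⟨add_neg_cancel_right _ _, add_neg_cancel_right _ _, rfl⟩)

/-! ## The map `ψ` -/

/-- The multi-index `(w_1, …, w_r, |x_{r+1}|, 0, …, 0)`. -/
def psiM (a : SheuSigma ℓ) (i : Fin ℓ) : ℕ :=
  if i.1 < (firstTop a.1.2.2).1 then (a.1.2.2 i).toNat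
  else if i.1 = (firstTop a.1.2.2).1 then (a.1.2.1 i).natAbs else 0

/-- The multi-index `(x_1 + w_1, …, x_r + w_r, x_{r+1} + |x_{r+1}|, 0, …, 0)`. -/
def psiN (a : SheuSigma ℓ) (i : Fin ℓ) : ℕ :=
  if i.1 < (firstTop a.1.2.2).1 then (a.1.2.1 i + (a.1.2.2 i).toNat).toNat
  else if i.1 = (firstTop a.1.2.2).1 then (a.1.2.1 i + (a.1.2.1 i).natAbs).toNat else 0

/-- The integer `z + ∑_{j ≤ r} x_j`. -/
def psiT (a : SheuSigma ℓ) : ℤ :=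
  a.1.1 + ∑ j : Fin ℓ, if j.1 < (firstTop a.1.2.2).1 then a.1.2.1 j else 0

/-- The element `B_{r+1}(t, m, n)` of `T` in the definition of `ψ`. -/
def psiB (a : SheuSigma ℓ) : InvT ℓ := elemB (firstTop a.1.2.2) (psiT a) (psiM a) (psiN a)

theorem phi_mem_domain (a : SheuSigma ℓ) :
    phi a.1.2.2 ∈ InverseSemigroup₀.domain (psiB a) := by
  have e : InverseSemigroup₀.rangeProj (psiB a) = projB (firstTop a.1.2.2) (psiM a) :=
    Subtype.ext (elemB_mul_star _ _ _ _)
  change (phi a.1.2.2).1 (InverseSemigroup₀.rangeProj (psiB a)) = true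
  rw [e]
  simp only [phi, decide_eq_true_eq]
  refine inFilter_projB fun i hi => ?_
  rw [psiM, if_pos hi]
  exact ENat.natCast_toNat (ne_top_of_lt_firstTop hi)

/-- The germ `ψ(z, x, w) = [φ(w), B_{r+1}(t, m, n)]`. -/
def psi (a : SheuSigma ℓ) : InverseSemigroup₀.GermGroupoid (InvT ℓ) :=
  InverseSemigroup₀.germ (phi a.1.2.2) (psiB a) (phi_mem_domain a)

end

end QSphere

namespace QSphere

open InverseSemigroup₀

variable {ℓ : ℕ}

/-! ## Elements of `T` as partial translations -/

/-! Every element of `T` acts on the basis of the Hilbert space as a restricted translation `(a, b)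
↦ (a + x, b - z)`, and a nonzero element determines the vector `(z, x)`. Two elements with the same
vector agree on their common domain. A germ `[y, s]` is therefore the same thing as the character
`y` together with the vector of `s`; this is `germ_eq_germ_iff`. The element `B_{r+1}(t, m, n)` in
the definition of `ψ` is a translation by exactly `(z, x)` (`translates_psiB`), so that `ψ(z, x, w)`
amounts to the triple `(φ(w), z, x)`. The rest is a study of the characters and of the vectors
allowed over each of them.

A projection lies in the filter of `w` if and only if it is the identity on all points that agree
with `w` before the first infinite coordinate and are large there (`inFilter_iff`). Hence `φ(w)`
sees `w` only up to its first infinite coordinate, and `φ(w) = φ(w')` is precisely the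
identification made in Sheu's quotient (`phi_eq_phi_iff`). A translation carries such points for `w`
to such points for `x + w`, so that it moves `φ(w)` to `φ(x + w)` (`act_phi`). The tight characters
are exactly the `φ(w)` (`tightSpectrum_eq_range`), and the vectors of elements defined at `φ(w)`
satisfy the conditions of `Σ` (`Translates.mem_sheuSigma`). This makes the induced map bijective; it
respects products and inverses because vectors add under multiplication and change sign under the
adjoint.

For the topology, a basic open set of germs pulls back to a condition `φ(w) ∈ U` with `(z, x)`
fixed, which gives continuity from that of `φ`. Openness on saturated sets follows from compactness
of `(ℕ ∪ {∞})^ℓ`: the image under `φ` of a closed set of bad points is closed and can be removed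
from the domain of `s`. -/

/-- The partial bijection of `ℕ^ℓ × ℤ` underlying an element of `T`. -/
noncomputable def shiftOf (s : InvT ℓ) : ((Fin ℓ → ℕ) × ℤ) ≃. ((Fin ℓ → ℕ) × ℤ) :=
  Classical.choose (exists_shift_of_mem s.2)

theorem partialShift_shiftOf (s : InvT ℓ) : partialShift (shiftOf s) = s.1 :=
  (Classical.choose_spec (exists_shift_of_mem s.2)).symm

theorem shiftOf_eq {s : InvT ℓ} {f} (h : s.1 = partialShift f) : shiftOf s = f :=
  partialShift_injective ((partialShift_shiftOf s).trans h)

theorem shiftOf_injective : Function.Injective (shiftOf : InvT ℓ → _) := fun s t h =>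
  Subtype.ext (by rw [← partialShift_shiftOf, ← partialShift_shiftOf, h])

theorem shiftOf_mul (s t : InvT ℓ) : shiftOf (s * t) = (shiftOf s).trans (shiftOf t) :=
  shiftOf_eq (by
    rw [← partialShift_mul, partialShift_shiftOf, partialShift_shiftOf]; rfl)

theorem shiftOf_star (s : InvT ℓ) : shiftOf (star s) = (shiftOf s).symm :=
  shiftOf_eq (by rw [← partialShift_star, partialShift_shiftOf]; rfl)

theorem shiftOf_zero : shiftOf (0 : InvT ℓ) = ⊥ := shiftOf_eq partialShift_bot.symm

theorem shiftOf_elemB (k : Fin (ℓ + 1)) (r : ℤ) (m n : Fin ℓ → ℕ) :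
    shiftOf (elemB k r m n) = shiftB k (expo k r m n) m n := shiftOf_eq (opB_eq k r m n)

/-- The set of `a ∈ ℕ^ℓ` with `a_i = m_i` for `i < k` and `a_k ≥ m_k`. -/
def cyl (k : Fin (ℓ + 1)) (m : Fin ℓ → ℕ) : Set (Fin ℓ → ℕ) := {a | ∀ i, legDom k m i (a i)}

/-- The displacement of the partial translation underlying `B_k(r, m, n)`. -/
def disp (k : Fin (ℓ + 1)) (m n : Fin ℓ → ℕ) (i : Fin ℓ) : ℤ :=
  if i.1 ≤ k.1 then (n i : ℤ) - m i else 0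

/-- On the cylinder, the coordinates before `k` are pinned to those of `m`, and the one at `k` is at
least that of `m`. Replacing `m i` by `n i` and the truncated subtraction in `legMap` are then both
honest additions of `n i - m i`. -/
theorem shiftOf_elemB_eq_some {k : Fin (ℓ + 1)} {r : ℤ} {m n a a' : Fin ℓ → ℕ} {b b' : ℤ} :
    shiftOf (elemB k r m n) (a, b) = some (a', b') ↔
      a ∈ cyl k m ∧ (∀ i, (a' i : ℤ) = a i + disp k m n i) ∧ b' = b - expo k r m n := by
  classical
  have e : shiftOf (elemB k r m n) (a, b) = if a ∈ cyl k m then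
      some (fun i => legMap k m n i (a i), b - expo k r m n) else none := by
    rw [shiftOf_elemB]
    by_cases h : a ∈ cyl k m
    · exact (if_pos h).trans (if_pos h).symm
    · exact (if_neg h).trans (if_neg h).symm
  rw [e, Option.ite_none_right_eq_some, Option.some.injEq, Prod.mk.injEq]
  refine and_congr_right fun ha => and_congr ?_ eq_comm
  rw [funext_iff]
  refine forall_congr' fun i => ?_
  have := ha i
  unfold legDom at this
  unfold legMap disp
  split_ifs <;> omega

theorem shiftOf_projB_eq_some {k : Fin (ℓ + 1)} {m : Fin ℓ → ℕ} {c c' : (Fin ℓ → ℕ) × ℤ} :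
    shiftOf (projB k m).1 c = some c' ↔ c.1 ∈ cyl k m ∧ c' = c := by
  obtain ⟨a, b⟩ := c
  obtain ⟨a', b'⟩ := c'
  refine shiftOf_elemB_eq_some.trans (and_congr_right fun _ => ?_)
  simp [disp, expo, Prod.ext_iff, funext_iff]

theorem eq_zero_or_elemB (s : InvT ℓ) : s = 0 ∨ ∃ k r m n, s = elemB k r m n := by
  obtain ⟨A, rfl | ⟨k, r, m, n, rfl⟩⟩ := s
  · exact Or.inl rfl
  · exact Or.inr ⟨k, r, m, n, rfl⟩

theorem rangeProj_elemB (k : Fin (ℓ + 1)) (r : ℤ) (m n : Fin ℓ → ℕ) :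
    rangeProj (elemB k r m n) = projB k m := Subtype.ext (elemB_mul_star k r m n)

/-- A projection equals its own range projection, and passing to range projections discards `r` and
replaces `n` by `m`. -/
theorem eq_zero_or_projB (e : Proj (InvT ℓ)) : e = 0 ∨ ∃ k m, e = projB k m := by
  obtain ⟨s, h1, h2⟩ := e
  rcases eq_zero_or_elemB s with rfl | ⟨k, r, m, n, rfl⟩
  · exact Or.inl rfl
  · refine Or.inr ⟨k, m, Subtype.ext ?_⟩
    change elemB k r m n = elemB k 0 m m
    rw [← elemB_mul_star k r m n, h1, h2]

theorem shiftOf_proj {e : Proj (InvT ℓ)} {c c' : (Fin ℓ → ℕ) × ℤ}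
    (h : shiftOf e.1 c = some c') : c' = c := by
  rcases eq_zero_or_projB e with rfl | ⟨k, m, rfl⟩
  · have h' : shiftOf (0 : InvT ℓ) c = some c' := h
    rw [shiftOf_zero] at h'
    exact absurd h' (Option.some_ne_none _).symm
  · exact (shiftOf_projB_eq_some.1 h).2

/-- Projections are partial identities, and composing partial identities intersects their domains.
The order of projections thus becomes inclusion of domains. -/
theorem projB_mul_eq_iff {k : Fin (ℓ + 1)} {m : Fin ℓ → ℕ} {e : Proj (InvT ℓ)} :
    projB k m * e = projB k m ↔ ∀ a ∈ cyl k m, ∀ b, shiftOf e.1 (a, b) = some (a, b) := by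
  have h0 : projB k m * e = projB k m ↔
      (shiftOf (projB k m).1).trans (shiftOf e.1) = shiftOf (projB k m).1 := by
    rw [← shiftOf_mul, shiftOf_injective.eq_iff]
    exact Subtype.ext_iff
  rw [h0]
  constructor
  · intro h a ha b
    have h1 : shiftOf (projB k m).1 (a, b) = some (a, b) := shiftOf_projB_eq_some.2 ⟨ha, rfl⟩
    have h2 := h1
    rw [← h, PEquiv.trans_eq_some] at h2
    obtain ⟨c, hc, hce⟩ := h2
    rwa [shiftOf_proj hc] at hce
  · intro h
    ext c c'
    rw [PEquiv.trans_eq_some]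
    constructor
    · rintro ⟨d, hd, hde⟩
      rw [hd, shiftOf_proj hde]
    · intro hc
      obtain ⟨h1, rfl⟩ := shiftOf_projB_eq_some.1 hc
      exact ⟨_, hc, h _ h1 _⟩

theorem projB_mul_projB_iff {k j : Fin (ℓ + 1)} {m m' : Fin ℓ → ℕ} :
    projB k m * projB j m' = projB k m ↔ cyl k m ⊆ cyl j m' := by
  rw [projB_mul_eq_iff]
  simp only [shiftOf_projB_eq_some, and_true, forall_const]
  rfl

theorem exists_mem_cyl_of_mul_ne_zero {k j : Fin (ℓ + 1)} {m m' : Fin ℓ → ℕ}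
    (h : projB k m * projB j m' ≠ 0) : (cyl k m ∩ cyl j m').Nonempty := by
  by_contra hne
  refine h (Subtype.ext (shiftOf_injective ?_))
  change shiftOf ((projB k m).1 * (projB j m').1) = shiftOf 0
  rw [shiftOf_mul, shiftOf_zero]
  ext c c'
  rw [PEquiv.trans_eq_some]
  constructor
  · rintro ⟨d, hd, hde⟩
    obtain ⟨h1, rfl⟩ := shiftOf_projB_eq_some.1 hd
    exact absurd ⟨_, h1, (shiftOf_projB_eq_some.1 hde).1⟩ hne
  · intro hc
    exact absurd hc (Option.some_ne_none _).symm

/-! ### Translation vectors and germs -/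

/-- `s` acts on its domain as the translation `(a, b) ↦ (a + x, b - z)`. -/
def Translates (s : InvT ℓ) (z : ℤ) (x : Fin ℓ → ℤ) : Prop :=
  ∀ a b a' b', shiftOf s (a, b) = some (a', b') → (∀ i, (a' i : ℤ) = a i + x i) ∧ b' = b - z

theorem translates_elemB (k : Fin (ℓ + 1)) (r : ℤ) (m n : Fin ℓ → ℕ) :
    Translates (elemB k r m n) (expo k r m n) (disp k m n) := fun _ _ _ _ h =>
  (shiftOf_elemB_eq_some.1 h).2

theorem Translates.mul {s t : InvT ℓ} {z z' : ℤ} {x x' : Fin ℓ → ℤ} (hs : Translates s z x)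
    (ht : Translates t z' x') : Translates (s * t) (z + z') (x + x') := by
  intro a b a' b' h
  rw [shiftOf_mul, PEquiv.trans_eq_some] at h
  obtain ⟨⟨a₁, b₁⟩, h1, h2⟩ := h
  obtain ⟨h3, h4⟩ := hs _ _ _ _ h1
  obtain ⟨h5, h6⟩ := ht _ _ _ _ h2
  refine ⟨fun i => ?_, ?_⟩
  · rw [h5, h3, Pi.add_apply, add_assoc]
  · rw [h6, h4, sub_sub]

theorem Translates.star {s : InvT ℓ} {z : ℤ} {x : Fin ℓ → ℤ} (hs : Translates s z x) :
    Translates (star s) (-z) (-x) := by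
  intro a b a' b' h
  rw [shiftOf_star] at h
  obtain ⟨h1, h2⟩ := hs _ _ _ _ ((shiftOf s).eq_some_iff.1 h)
  refine ⟨fun i => ?_, ?_⟩
  · rw [h1, Pi.neg_apply]; ring
  · rw [h2]; ring

theorem translates_proj (e : Proj (InvT ℓ)) : Translates e.1 0 0 := by
  intro a b a' b' h
  obtain ⟨rfl, rfl⟩ := Prod.mk.injEq .. ▸ shiftOf_proj h
  simp

theorem exists_shiftOf_eq_some {s : InvT ℓ} (h : s ≠ 0) : ∃ c c', shiftOf s c = some c' := by
  by_contra hne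
  push Not at hne
  refine h (shiftOf_injective ?_)
  rw [shiftOf_zero]
  ext c c'
  exact ⟨fun hc => absurd hc (hne c c'), fun hc => absurd hc (Option.some_ne_none _).symm⟩

/-- One point of the domain already determines the vector. The zero element has no such point and
translates by every vector, vacuously. -/
theorem Translates.unique {s : InvT ℓ} (h : s ≠ 0) {z z' : ℤ} {x x' : Fin ℓ → ℤ}
    (h1 : Translates s z x) (h2 : Translates s z' x') : z = z' ∧ x = x' := by
  obtain ⟨⟨a, b⟩, ⟨a', b'⟩, hc⟩ := exists_shiftOf_eq_some h
  obtain ⟨h3, h4⟩ := h1 _ _ _ _ hc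
  obtain ⟨h5, h6⟩ := h2 _ _ _ _ hc
  refine ⟨by omega, funext fun i => ?_⟩
  have := h3 i
  have := h5 i
  omega

/-- Both sides are the same translation restricted to the intersection of the two domains. -/
theorem Translates.rangeProj_mul_comm {s t : InvT ℓ} {z : ℤ} {x : Fin ℓ → ℤ}
    (hs : Translates s z x) (ht : Translates t z x) :
    (rangeProj t).1 * s = (rangeProj s).1 * t := by
  have key : ∀ {s t : InvT ℓ}, Translates s z x → Translates t z x → ∀ c c',
      shiftOf ((rangeProj t).1 * s) c = some c' → shiftOf ((rangeProj s).1 * t) c = some c' := by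
    rintro s t hs ht ⟨a, b⟩ ⟨a', b'⟩ h
    rw [shiftOf_mul, PEquiv.trans_eq_some] at h ⊢
    obtain ⟨d, hd, hds⟩ := h
    obtain rfl := shiftOf_proj hd
    change shiftOf (t * Star.star t) _ = _ at hd
    rw [shiftOf_mul, PEquiv.trans_eq_some] at hd
    obtain ⟨⟨a₁, b₁⟩, h1, -⟩ := hd
    have e : ((a₁, b₁) : (Fin ℓ → ℕ) × ℤ) = (a', b') := by
      obtain ⟨h3, h4⟩ := hs _ _ _ _ hds
      obtain ⟨h5, h6⟩ := ht _ _ _ _ h1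
      refine Prod.ext (funext fun i => ?_) (by rw [h4, h6])
      have := h3 i
      have := h5 i
      dsimp only
      omega
    rw [e] at h1
    refine ⟨(a, b), ?_, h1⟩
    change shiftOf (s * Star.star s) _ = _
    rw [shiftOf_mul, PEquiv.trans_eq_some]
    refine ⟨_, hds, ?_⟩
    rw [shiftOf_star]
    exact (shiftOf s).eq_some_iff.2 hds
  apply shiftOf_injective
  ext c c'
  exact ⟨key hs ht c c', key ht hs c c'⟩

theorem ne_zero_of_mem_domain {y : Character (InvT ℓ)} {s : InvT ℓ} (h : y ∈ domain s) :
    s ≠ 0 := by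
  rintro rfl
  have e : rangeProj (0 : InvT ℓ) = 0 := Subtype.ext (zero_mul _)
  have h' : y.1 (rangeProj 0) = true := h
  rw [e, y.2.2.1] at h'
  exact Bool.false_ne_true h'

/-- This reduces all questions about germs to characters and integer vectors. Equal germs share a
nonzero restriction, which determines the vector; conversely, elements with the same vector agree on
their common domain. -/
theorem germ_eq_germ_iff {y y' : Character (InvT ℓ)} {s t : InvT ℓ} {hs : y ∈ domain s}
    {ht : y' ∈ domain t} {z z' : ℤ} {x x' : Fin ℓ → ℤ} (h1 : Translates s z x)
    (h2 : Translates t z' x') :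
    germ y s hs = germ y' t ht ↔ y = y' ∧ z = z' ∧ x = x' := by
  constructor
  · intro h
    obtain ⟨rfl, e, he, hst⟩ := Quotient.exact h
    change e.1 * s = e.1 * t at hst
    change y.1 e = true at he
    refine ⟨rfl, ?_⟩
    -- If `e s` vanished, so would `e (s s*)`, although `y` takes the value `1` on both factors.
    have hne : e.1 * s ≠ 0 := by
      intro h0
      have h3 : e * rangeProj s = 0 := Subtype.ext (by
        change e.1 * (s * star s) = 0
        rw [← mul_assoc, h0, zero_mul])
      have h4 := y.2.1 e (rangeProj s)
      have hs' : y.1 (rangeProj s) = true := hs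
      rw [h3, y.2.2.1, he, hs'] at h4
      exact Bool.false_ne_true h4
    have h5 := Translates.unique hne ((translates_proj e).mul h1)
      (hst ▸ (translates_proj e).mul h2)
    simpa using h5
  · rintro ⟨rfl, rfl, rfl⟩
    refine Quotient.sound ⟨rfl, rangeProj s * rangeProj t, ?_, ?_⟩
    · have hs' : y.1 (rangeProj s) = true := hs
      have ht' : y.1 (rangeProj t) = true := ht
      change y.1 _ = true
      rw [y.2.1, hs', ht']; rfl
    · change (rangeProj s).1 * (rangeProj t).1 * s = (rangeProj s).1 * (rangeProj t).1 * t
      have e1 : (rangeProj t).1 * t = t := mul_star_mul t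
      rw [mul_assoc, h1.rangeProj_mul_comm h2, mul_assoc, e1, ← mul_assoc, (rangeProj s).2.2]

/-! ## The characters `φ(w)` -/

theorem eq_top_of_eq_firstTop {w : Fin ℓ → ℕ∞} {i : Fin ℓ} (h : i.1 = (firstTop w).1) :
    w i = ⊤ := by
  classical
  have h1 := Nat.find_spec (exists_firstTop w)
  have h2 : i.1 = Nat.find (exists_firstTop w) := h
  have h3 : i = ⟨Nat.find (exists_firstTop w), h2 ▸ i.2⟩ := Fin.ext h2
  rw [h3]
  exact h1 _

theorem firstTop_unique {w : Fin ℓ → ℕ∞} {r : Fin (ℓ + 1)} (h : ∀ i : Fin ℓ, i.1 < r.1 → w i ≠ ⊤)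
    (h' : ∀ i : Fin ℓ, i.1 = r.1 → w i = ⊤) : firstTop w = r := by
  apply Fin.ext
  rcases lt_trichotomy (firstTop w).1 r.1 with h1 | h1 | h1
  · exact absurd (eq_top_of_eq_firstTop (i := ⟨(firstTop w).1, by omega⟩) rfl) (h _ h1)
  · exact h1
  · have h2 : r.1 < ℓ := by omega
    exact absurd (h' ⟨r.1, h2⟩ rfl) (ne_top_of_lt_firstTop h1)

/-- The points of `ℕ^ℓ` that agree with `w` before its first infinite coordinate, at which they
are at least `N`. -/
def near (w : Fin ℓ → ℕ∞) (N : ℕ) : Set (Fin ℓ → ℕ) :=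
  {a | ∀ i : Fin ℓ, (i.1 < (firstTop w).1 → (a i : ℕ∞) = w i) ∧ (i.1 = (firstTop w).1 → N ≤ a i)}

/-- The set `near w N` is the cylinder of a generator of the filter whose entry at the first
infinite coordinate is `N`; entries further on do not matter. -/
theorem inFilter_iff {w : Fin ℓ → ℕ∞} {e : Proj (InvT ℓ)} :
    InFilter w e ↔ ∃ N, ∀ a ∈ near w N, ∀ b, shiftOf e.1 (a, b) = some (a, b) := by
  unfold InFilter
  simp only [projB_mul_eq_iff]
  constructor
  · rintro ⟨m, hm, h⟩
    -- The sum is only an upper bound for the entry of `m` at the first infinite coordinate. It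
    -- avoids a case distinction, as that coordinate does not exist when `w` is finite.
    refine ⟨∑ i, m i, fun a ha => h a fun i => ⟨fun hi => ?_, fun hi => ?_⟩⟩
    · exact_mod_cast ((ha i).1 hi).trans (hm i hi).symm
    · exact (Finset.single_le_sum (fun _ _ => Nat.zero_le _) (Finset.mem_univ i)).trans
        ((ha i).2 hi)
  · rintro ⟨N, h⟩
    refine ⟨fun i => if i.1 < (firstTop w).1 then (w i).toNat else N, fun i hi => ?_,
      fun a ha => h a fun i => ⟨fun hi => ?_, fun hi => ?_⟩⟩
    · dsimp only
      rw [if_pos hi, ENat.natCast_toNat (ne_top_of_lt_firstTop hi)]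
    · have := (ha i).1 hi
      dsimp only at this
      rw [if_pos hi] at this
      rw [this, ENat.natCast_toNat (ne_top_of_lt_firstTop hi)]
    · have := (ha i).2 hi
      dsimp only at this
      rwa [if_neg (by omega)] at this

/-- The value of `φ(w)` on a nonzero projection is a conjunction of conditions on single coordinates
of `w`. Continuity, injectivity modulo truncation and the conditions of `Σ` are all read off from
this form. -/
theorem inFilter_projB_iff {w : Fin ℓ → ℕ∞} {k : Fin (ℓ + 1)} {m : Fin ℓ → ℕ} :
    InFilter w (projB k m) ↔
      ∀ i : Fin ℓ, (i.1 < k.1 → w i = m i) ∧ (i.1 = k.1 → (m i : ℕ∞) ≤ w i) := by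
  rw [inFilter_iff]
  simp only [shiftOf_projB_eq_some, and_true, forall_const]
  constructor
  · rintro ⟨N, h⟩
    -- A test point in `near w N`. From the first infinite coordinate on it strictly exceeds `m`, so
    -- it can lie in the cylinder of `p_k(m)` only if all coordinates of `w` before `k` are finite.
    set a : Fin ℓ → ℕ := fun i =>
      if i.1 < (firstTop w).1 then (w i).toNat else max N (m i + 1) with ha
    have h1 : a ∈ near w N := by
      refine fun i => ⟨fun hi => ?_, fun hi => ?_⟩
      · simp only [ha, if_pos hi]
        exact ENat.natCast_toNat (ne_top_of_lt_firstTop hi)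
      · simp only [ha, if_neg (show ¬ i.1 < (firstTop w).1 by omega)]
        exact le_max_left _ _
    have h2 : ∀ i : Fin ℓ, i.1 < k.1 → i.1 < (firstTop w).1 := by
      intro i hi
      by_contra hn
      have := (h a h1 i).1 hi
      simp only [ha, if_neg hn] at this
      omega
    intro i
    refine ⟨fun hi => ?_, fun hi => ?_⟩
    · have h3 := (h a h1 i).1 hi
      rw [← h3]
      exact ((h1 i).1 (h2 i hi)).symm
    · by_cases hr : i.1 < (firstTop w).1
      · rw [← (h1 i).1 hr]
        exact_mod_cast (h a h1 i).2 hi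
      · have hk : k.1 ≤ (firstTop w).1 := by
          by_contra hk
          have := h2 ⟨(firstTop w).1, by omega⟩ (by simpa using hk)
          simp at this
        rw [eq_top_of_eq_firstTop (w := w) (i := i) (by omega)]
        exact le_top
  · intro h
    have hk : k.1 ≤ (firstTop w).1 := by
      by_contra hk
      have h1 := (h ⟨(firstTop w).1, by omega⟩).1 (by simpa using hk)
      rw [eq_top_of_eq_firstTop (w := w) rfl] at h1
      exact ENat.natCast_ne_top _ h1.symm
    refine ⟨∑ i, m i, fun a ha i => ⟨fun hi => ?_, fun hi => ?_⟩⟩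
    · have h1 := ((ha i).1 (by omega)).trans ((h i).1 hi)
      exact_mod_cast h1
    · rcases (show i.1 ≤ (firstTop w).1 by omega).lt_or_eq with hr | hr
      · have h1 := (h i).2 hi
        rw [← (ha i).1 hr] at h1
        exact_mod_cast h1
      · exact (Finset.single_le_sum (fun _ _ => Nat.zero_le _) (Finset.mem_univ i)).trans
          ((ha i).2 hr)

theorem phi_apply {w : Fin ℓ → ℕ∞} {e : Proj (InvT ℓ)} : (phi w).1 e = true ↔ InFilter w e := by
  simp [phi]

theorem isClopen_setOf_phi (e : Proj (InvT ℓ)) :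
    IsClopen {w : Fin ℓ → ℕ∞ | (phi w).1 e = true} := by
  simp only [phi_apply]
  rcases eq_zero_or_projB e with rfl | ⟨k, m, rfl⟩
  · simp [not_inFilter_zero, isClopen_empty]
  · have e1 : {w : Fin ℓ → ℕ∞ | InFilter w (projB k m)} =
        ⋂ i : Fin ℓ, (fun w : Fin ℓ → ℕ∞ => w i) ⁻¹'
          {v | (i.1 < k.1 → v = m i) ∧ (i.1 = k.1 → (m i : ℕ∞) ≤ v)} := by
      ext w
      simp [inFilter_projB_iff]
    rw [e1]
    refine isClopen_iInter_of_finite fun i => IsClopen.preimage ?_ (continuous_apply i)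
    rcases lt_trichotomy i.1 k.1 with h | h | h
    · have h' : i.1 ≠ k.1 := h.ne
      simp only [h, h', true_imp_iff, false_imp_iff, and_true, Set.ofPred_eq_eq_singleton]
      exact ⟨isClosed_singleton, ENat.isOpen_singleton (ENat.natCast_ne_top _)⟩
    · simp only [h, lt_irrefl, true_imp_iff, false_imp_iff, true_and]
      refine ⟨isClosed_Ici, ?_⟩
      rw [← isClosed_compl_iff]
      -- The complement of a neighbourhood `[m i, ∞]` of infinity is finite, hence closed.
      have e2 : {v : ℕ∞ | (m i : ℕ∞) ≤ v}ᶜ = Nat.cast '' {n : ℕ | n < m i} := by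
        ext v
        simp only [Set.mem_compl_iff, Set.mem_ofPred_eq, not_le, Set.mem_image]
        constructor
        · intro hv
          lift v to ℕ using hv.ne_top
          exact ⟨v, by exact_mod_cast hv, rfl⟩
        · rintro ⟨n, hn, rfl⟩
          exact_mod_cast hn
      rw [e2]
      exact ((Set.finite_lt_nat _).image _).isClosed
    · have h1 : ¬ i.1 < k.1 := by omega
      have h2 : i.1 ≠ k.1 := by omega
      simp [h1, h2, isClopen_univ]

theorem continuous_phi : Continuous (phi : (Fin ℓ → ℕ∞) → Character (InvT ℓ)) := by
  refine Continuous.subtype_mk (continuous_pi fun e => ?_) _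
  exact (continuous_bool_rng true).2 (isClopen_setOf_phi e)

theorem trunc_apply (w : Fin ℓ → ℕ∞) (i : Fin ℓ) :
    trunc w i = if i.1 < (firstTop w).1 then w i else ⊤ := by
  classical
  unfold trunc
  split_ifs with h1 h2 h2
  · obtain ⟨j, hj, hw⟩ := h1
    exact absurd hw (ne_top_of_lt_firstTop (lt_trans hj h2))
  · rfl
  · rfl
  · rcases (not_lt.1 h2).lt_or_eq with h3 | h3
    · exact absurd ⟨⟨(firstTop w).1, by omega⟩, h3, eq_top_of_eq_firstTop rfl⟩ h1
    · exact eq_top_of_eq_firstTop h3.symm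

theorem firstTop_trunc (w : Fin ℓ → ℕ∞) : firstTop (trunc w) = firstTop w := by
  refine firstTop_unique (fun i hi => ?_) fun i hi => ?_
  · rw [trunc_apply, if_pos hi]
    exact ne_top_of_lt_firstTop hi
  · rw [trunc_apply, if_neg (by omega)]

theorem near_trunc (w : Fin ℓ → ℕ∞) (N : ℕ) : near (trunc w) N = near w N := by
  unfold near
  rw [firstTop_trunc]
  ext a
  refine forall_congr' fun i => and_congr_left fun _ => forall_congr' fun hi => ?_
  rw [trunc_apply, if_pos hi]

theorem phi_trunc (w : Fin ℓ → ℕ∞) : phi (trunc w) = phi w := by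
  apply Subtype.ext
  funext e
  rw [Bool.eq_iff_iff, phi_apply, phi_apply, inFilter_iff, inFilter_iff]
  simp only [near_trunc]

/-- The filter of `w` contains projections that prescribe its finite initial coordinates and ask the
first infinite one to be at least `N`, for every `N`. If they also lie in the filter of `w'`, then
`w'` has the same initial coordinates and is infinite at the same place. -/
theorem phi_eq_phi_iff {w w' : Fin ℓ → ℕ∞} : phi w = phi w' ↔ trunc w = trunc w' := by
  constructor
  · have key : ∀ w w' : Fin ℓ → ℕ∞, phi w = phi w' →
        (∀ i : Fin ℓ, i.1 < (firstTop w).1 → w' i = w i) ∧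
        (∀ i : Fin ℓ, i.1 = (firstTop w).1 → w' i = ⊤) := by
      intro w w' h
      have h1 : ∀ N : ℕ, InFilter w' (projB (firstTop w) fun i =>
          if i.1 < (firstTop w).1 then (w i).toNat else N) := by
        intro N
        rw [← phi_apply, ← h, phi_apply, inFilter_projB_iff]
        refine fun i => ⟨fun hi => ?_, fun hi => ?_⟩
        · rw [if_pos hi, ENat.natCast_toNat (ne_top_of_lt_firstTop hi)]
        · rw [eq_top_of_eq_firstTop hi]
          exact le_top
      simp only [inFilter_projB_iff] at h1
      refine ⟨fun i hi => ?_, fun i hi => ?_⟩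
      · rw [(h1 0 i).1 hi, if_pos hi, ENat.natCast_toNat (ne_top_of_lt_firstTop hi)]
      · refine ENat.eq_top_iff_forall_ge.2 fun N => ?_
        have := (h1 N i).2 hi
        rwa [if_neg (by omega)] at this
    intro h
    obtain ⟨h1, h2⟩ := key w w' h
    have h3 : firstTop w' = firstTop w := firstTop_unique
      (fun i hi => by rw [h1 i hi]; exact ne_top_of_lt_firstTop hi) h2
    funext i
    rw [trunc_apply, trunc_apply, h3]
    split_ifs with hi
    · exact (h1 i hi).symm
    · rfl
  · intro h
    rw [← phi_trunc, h, phi_trunc]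

/-! ### Translations acting on the characters `φ(w)` -/

theorem translate_coe (x : ℤ) {w : ℕ∞} (h : w ≠ ⊤) :
    translate x w = ((x + w.toNat).toNat : ℕ∞) := if_neg h

theorem firstTop_sheuSrc (a : SheuSigma ℓ) : firstTop (sheuSrc a) = firstTop a.1.2.2 :=
  firstTop_unique (fun _ hi h => ne_top_of_lt_firstTop hi (translate_eq_top.1 h))
    fun _ hi => translate_eq_top.2 (eq_top_of_eq_firstTop hi)

theorem x_eq_zero_of_firstTop_lt {a : SheuSigma ℓ} {i : Fin ℓ} (h : (firstTop a.1.2.2).1 < i.1) :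
    a.1.2.1 i = 0 :=
  (a.2.2 ⟨(firstTop a.1.2.2).1, by omega⟩ (eq_top_of_eq_firstTop rfl)).1 i h

/-- The sum of the `|x_i|` bounds the loss at the first infinite coordinate, the only place where
the size of a point matters. -/
theorem mem_near_sheuSrc {a : SheuSigma ℓ} {N : ℕ} {u v : Fin ℓ → ℕ} (hu : u ∈ near a.1.2.2 N)
    (hv : ∀ i, (v i : ℤ) = u i + a.1.2.1 i) {N' : ℕ} (hN : N' + ∑ i, (a.1.2.1 i).natAbs ≤ N) :
    v ∈ near (sheuSrc a) N' := by
  unfold near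
  rw [firstTop_sheuSrc]
  refine fun i => ⟨fun hi => ?_, fun hi => ?_⟩
  · have h1 := (hu i).1 hi
    have h2 := hv i
    unfold sheuSrc
    rw [translate_coe _ (ne_top_of_lt_firstTop hi), ← h1, ENat.toNat_natCast]
    congr 1
    omega
  · have h1 := (hu i).2 hi
    have h2 := hv i
    have h3 : (a.1.2.1 i).natAbs ≤ ∑ i, (a.1.2.1 i).natAbs :=
      Finset.single_le_sum (f := fun i => (a.1.2.1 i).natAbs) (fun _ _ => Nat.zero_le _)
        (Finset.mem_univ i)
    omega

/-- The preimage is `v - x`, and the point is that it has no negative entry: before the first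
infinite coordinate it equals `w`, at that coordinate `v` is large, and further on `x` vanishes by
the definition of `Σ`. -/
theorem exists_of_mem_near_sheuSrc {a : SheuSigma ℓ} {N : ℕ} {v : Fin ℓ → ℕ} {N' : ℕ}
    (hv : v ∈ near (sheuSrc a) N') (hN : N + ∑ i, (a.1.2.1 i).natAbs ≤ N') :
    ∃ u ∈ near a.1.2.2 N, ∀ i, (v i : ℤ) = u i + a.1.2.1 i := by
  unfold near at hv
  rw [firstTop_sheuSrc] at hv
  have h0 : ∀ i : Fin ℓ, i.1 < (firstTop a.1.2.2).1 →
      (v i : ℤ) = (a.1.2.2 i).toNat + a.1.2.1 i := by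
    intro i hi
    have h1 := (hv i).1 hi
    have h2 := ne_top_of_lt_firstTop hi
    have h3 := a.2.1 i h2
    unfold sheuSrc at h1
    rw [translate_coe _ h2] at h1
    have h4 : v i = (a.1.2.1 i + (a.1.2.2 i).toNat).toNat := by exact_mod_cast h1
    omega
  have h5 : ∀ i, (a.1.2.1 i).natAbs ≤ ∑ i, (a.1.2.1 i).natAbs := fun i =>
      Finset.single_le_sum (f := fun i => (a.1.2.1 i).natAbs) (fun _ _ => Nat.zero_le _)
        (Finset.mem_univ i)
  refine ⟨fun i => (v i - a.1.2.1 i).toNat, fun i => ⟨fun hi => ?_, fun hi => ?_⟩, fun i => ?_⟩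
  · have e : ((v i : ℤ) - a.1.2.1 i).toNat = (a.1.2.2 i).toNat := by
      have := h0 i hi
      omega
    dsimp only
    rw [e, ENat.natCast_toNat (ne_top_of_lt_firstTop hi)]
  · have := h5 i
    have := (hv i).2 hi
    dsimp only
    omega
  · dsimp only
    rcases lt_trichotomy i.1 (firstTop a.1.2.2).1 with hi | hi | hi
    · have := h0 i hi
      omega
    · have := h5 i
      have := (hv i).2 hi
      omega
    · have := x_eq_zero_of_firstTop_lt hi
      omega

theorem near_anti (w : Fin ℓ → ℕ∞) {N N' : ℕ} (h : N ≤ N') : near w N' ⊆ near w N :=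
  fun _ ha i => ⟨(ha i).1, fun hi => h.trans ((ha i).2 hi)⟩

theorem shiftOf_conj_eq_some {s : InvT ℓ} {e : Proj (InvT ℓ)} {c : (Fin ℓ → ℕ) × ℤ} :
    shiftOf (conj s e).1 c = some c ↔ ∃ d, shiftOf s c = some d ∧ shiftOf e.1 d = some d := by
  change shiftOf (s * e.1 * star s) c = some c ↔ _
  rw [shiftOf_mul, shiftOf_mul, PEquiv.trans_eq_some, shiftOf_star]
  simp only [PEquiv.trans_eq_some]
  constructor
  · rintro ⟨d, ⟨d', h1, h2⟩, -⟩
    obtain rfl := shiftOf_proj h2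
    exact ⟨_, h1, h2⟩
  · rintro ⟨d, h1, h2⟩
    exact ⟨d, ⟨d, h1, h2⟩, (shiftOf s).eq_some_iff.2 h1⟩

/-- The projection `s e s*` is the identity at a point when `s` sends that point to one fixed by
`e`. Since translation by `x` matches the sets `near w N` with those of `x + w` up to a change of
`N`, testing `s e s*` at `w` is testing `e` at `x + w`. -/
theorem act_phi {a : SheuSigma ℓ} {s : InvT ℓ} (hs : Translates s a.1.1 a.1.2.1)
    (h : phi a.1.2.2 ∈ domain s) : act (phi a.1.2.2) s h = phi (sheuSrc a) := by
  apply Subtype.ext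
  funext e
  rw [Bool.eq_iff_iff, phi_apply, inFilter_iff]
  change (phi a.1.2.2).1 (conj s e) = true ↔ _
  rw [phi_apply, inFilter_iff]
  constructor
  · rintro ⟨N, hN⟩
    refine ⟨N + ∑ i, (a.1.2.1 i).natAbs, fun v hv b => ?_⟩
    obtain ⟨u, hu, huv⟩ := exists_of_mem_near_sheuSrc (N := N) hv le_rfl
    -- The element `s` lowers the last coordinate by `z`, so starting at `b + z` ends at `b`.
    obtain ⟨⟨v', b'⟩, h1, h2⟩ := shiftOf_conj_eq_some.1 (hN u hu (b + a.1.1))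
    obtain ⟨h3, h4⟩ := hs _ _ _ _ h1
    obtain rfl : v' = v := funext fun i => by exact_mod_cast (h3 i).trans (huv i).symm
    obtain rfl : b' = b := by omega
    exact h2
  · rintro ⟨N', hN'⟩
    obtain ⟨M, hM⟩ := inFilter_iff.1 (phi_apply.1 h)
    -- The bound `M` keeps the points in the domain of `s`; the other one leaves room for the
    -- translation.
    refine ⟨max M (N' + ∑ i, (a.1.2.1 i).natAbs), fun u hu b => ?_⟩
    have h1 := hM u (near_anti _ (le_max_left _ _) hu) b
    change shiftOf (s * star s) _ = _ at h1
    rw [shiftOf_mul, PEquiv.trans_eq_some] at h1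
    obtain ⟨⟨v, b'⟩, h2, -⟩ := h1
    exact shiftOf_conj_eq_some.2 ⟨_, h2,
      hN' v (mem_near_sheuSrc hu (hs _ _ _ _ h2).1 (le_max_right _ _)) b'⟩

/-! ## The tight characters are the characters `φ(w)` -/

theorem character_mono {y : Character (InvT ℓ)} {e f : Proj (InvT ℓ)} (h : e * f = e)
    (he : y.1 e = true) : y.1 f = true := by
  have := y.2.1 e f
  rw [h, he] at this
  simpa using this.symm

theorem mul_ne_zero_of_character {y : Character (InvT ℓ)} {e f : Proj (InvT ℓ)}
    (he : y.1 e = true) (hf : y.1 f = true) : e * f ≠ 0 := by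
  intro h
  have := y.2.1 e f
  rw [h, y.2.2.1, he, hf] at this
  exact Bool.false_ne_true this

theorem exists_projB_of_character {y : Character (InvT ℓ)} {e : Proj (InvT ℓ)}
    (he : y.1 e = true) : ∃ k m, e = projB k m := by
  rcases eq_zero_or_projB e with rfl | h
  · rw [y.2.2.1] at he
    exact absurd he Bool.false_ne_true
  · exact h

/-- If a larger filter contains `p_k(m)`, then `p_k(m)` meets every member of the filter of `w`.
Meeting one whose first infinite coordinate is pushed beyond that of `m` already forces `p_k(m)` to
dominate it. -/
theorem isUltra_phi (w : Fin ℓ → ℕ∞) : IsUltra (phi w) := by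
  intro y hy e he
  obtain ⟨k, m, rfl⟩ := exists_projB_of_character he
  set M : Fin ℓ → ℕ := fun i =>
    if i.1 < (firstTop w).1 then (w i).toNat else m i + 1 with hM
  have hMw : ∀ i : Fin ℓ, i.1 < (firstTop w).1 → (M i : ℕ∞) = w i := by
    intro i hi
    simp only [hM, if_pos hi]
    exact ENat.natCast_toNat (ne_top_of_lt_firstTop hi)
  have hM' : ∀ i : Fin ℓ, i.1 = (firstTop w).1 → M i = m i + 1 := by
    intro i hi
    simp only [hM, if_neg (show ¬ i.1 < (firstTop w).1 by omega)]
  obtain ⟨a, h1, h2⟩ := exists_mem_cyl_of_mul_ne_zero (mul_ne_zero_of_character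
    (hy _ (phi_apply.2 (inFilter_projB hMw))) he)
  rw [phi_apply]
  refine ⟨M, hMw, projB_mul_projB_iff.2 fun b hb => ?_⟩
  -- Otherwise the common point would equal `m` at the first infinite coordinate while being at
  -- least `m + 1` there.
  have hk : k.1 ≤ (firstTop w).1 := by
    by_contra hk
    have hr : (firstTop w).1 < ℓ := by omega
    have h3 := (h2 ⟨_, hr⟩).1 (by simpa using hk)
    have h4 := (h1 ⟨_, hr⟩).2 rfl
    rw [hM' _ rfl] at h4
    omega
  refine fun i => ⟨fun hi => ?_, fun hi => ?_⟩
  · rw [(hb i).1 (by omega), ← (h1 i).1 (by omega), (h2 i).1 hi]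
  · rcases (show i.1 ≤ (firstTop w).1 by omega).lt_or_eq with hr | hr
    · rw [(hb i).1 hr, ← (h1 i).1 hr]
      exact (h2 i).2 hi
    · have := (hb i).2 hr
      rw [hM' i hr] at this
      omega

/-- The cover of `p_k(m)` by `p_k(m + e_k)` and `p_{k+1}(m_1, …, m_k, 0)` is respected by `y`. -/
def SplitAt (k : Fin ℓ) (m : Fin ℓ → ℕ) (y : Character (InvT ℓ)) : Prop :=
  y.1 (projB k.castSucc m) = true →
    y.1 (projB k.castSucc (Function.update m k (m k + 1))) = true ∨
    y.1 (projB k.succ fun i => if i ≤ k then m i else 0) = true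

theorem isClopen_setOf_character (e : Proj (InvT ℓ)) :
    IsClopen {y : Character (InvT ℓ) | y.1 e = true} :=
  (isClopen_discrete {true}).preimage ((continuous_apply e).comp continuous_subtype_val)

theorem isClosed_setOf_splitAt (k : Fin ℓ) (m : Fin ℓ → ℕ) : IsClosed {y | SplitAt k m y} := by
  have h := isClopen_setOf_character (ℓ := ℓ)
  convert (h (projB k.castSucc m)).compl.1.union
    ((h (projB k.castSucc (Function.update m k (m k + 1)))).1.union
      (h (projB k.succ fun i => if i ≤ k then m i else 0)).1) using 1
  ext y
  simp only [SplitAt, Set.mem_union, Set.mem_compl_iff, Set.mem_ofPred_eq]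
  tauto

/-- The point `(m_1, …, m_{k-1}, ∞, …, ∞)`. -/
noncomputable def topFrom (k : Fin (ℓ + 1)) (m : Fin ℓ → ℕ) (i : Fin ℓ) : ℕ∞ :=
  if i.1 < k.1 then m i else ⊤

theorem firstTop_topFrom (k : Fin (ℓ + 1)) (m : Fin ℓ → ℕ) : firstTop (topFrom k m) = k :=
  firstTop_unique (fun _ hi => by simp [topFrom, hi]) fun _ hi => by simp [topFrom, hi]

theorem inFilter_topFrom {k : Fin (ℓ + 1)} {m : Fin ℓ → ℕ} {e : Proj (InvT ℓ)} :
    InFilter (topFrom k m) e ↔ ∃ M : Fin ℓ → ℕ, (∀ i : Fin ℓ, i.1 < k.1 → M i = m i) ∧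
      projB k M * e = projB k M := by
  unfold InFilter
  rw [firstTop_topFrom]
  refine exists_congr fun M => and_congr_left fun _ => forall_congr' fun i =>
    forall_congr' fun hi => ?_
  rw [topFrom, if_pos hi]
  exact Nat.cast_inj

/-- Suppose that `p_k(m)` is in the support and neither piece is. A member `p_j(m')` with `j > k`
meets `p_k(m)` and has a fixed `k`-th coordinate, so it lies below one of the two pieces, which is
excluded. All members thus have `j ≤ k`, and they lie in the filter of `(m_1, …, m_{k-1}, ∞, …, ∞)`.
By maximality the two filters agree, but the latter contains the first piece. -/
theorem splitAt_of_isUltra {y : Character (InvT ℓ)} (hy : IsUltra y) (k : Fin ℓ) (m : Fin ℓ → ℕ) :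
    SplitAt k m y := by
  intro h
  by_contra hn
  obtain ⟨hn1, hn2⟩ := not_or.1 hn
  refine hn1 (hy (phi (topFrom k.castSucc m)) (fun e he => ?_) _ ?_)
  · obtain ⟨j, m', rfl⟩ := exists_projB_of_character he
    obtain ⟨a, h1, h2⟩ := exists_mem_cyl_of_mul_ne_zero (mul_ne_zero_of_character h he)
    have hk : ∀ i : Fin ℓ, (i.1 < k.1 → a i = m i) ∧ (i.1 = k.1 → m i ≤ a i) := h1
    rw [phi_apply, inFilter_topFrom]
    rcases le_or_gt j.1 k.1 with hjk | hjk
    · refine ⟨fun i => if i.1 < k.1 then m i else m' i, fun i hi => if_pos hi,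
        projB_mul_projB_iff.2 fun b hb i => ⟨fun hi => ?_, fun hi => ?_⟩⟩
      · have h3 := (hb i).1 (lt_of_lt_of_le hi hjk)
        dsimp only at h3
        rw [if_pos (by omega)] at h3
        rw [h3, ← (hk i).1 (by omega), (h2 i).1 hi]
      · rcases (show i.1 ≤ k.1 by omega).lt_or_eq with hr | hr
        · have h3 := (hb i).1 hr
          dsimp only at h3
          rw [if_pos hr] at h3
          rw [h3, ← (hk i).1 hr]
          exact (h2 i).2 hi
        · have h3 := (hb i).2 hr
          dsimp only at h3
          rwa [if_neg (by omega)] at h3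
    · exfalso
      -- The fixed `k`-th coordinate is either larger than `m k`, and the first piece dominates, or
      -- equal to it, and the second one does.
      rcases ((hk k).2 rfl).lt_or_eq with hlt | heq
      · refine hn1 (character_mono (projB_mul_projB_iff.2 fun b hb i => ⟨fun hi => ?_,
          fun hi => ?_⟩) he)
        · have hi' : i.1 < k.1 := hi
          rw [Function.update_of_ne (by rintro rfl; omega), (hb i).1 (by omega),
            ← (h2 i).1 (by omega)]
          exact (hk i).1 hi'
        · obtain rfl : i = k := Fin.ext hi
          rw [Function.update_self, (hb i).1 hjk, ← (h2 i).1 hjk]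
          exact hlt
      · refine hn2 (character_mono (projB_mul_projB_iff.2 fun b hb i => ⟨fun hi => ?_,
          fun hi => ?_⟩) he)
        · have hi' : i.1 ≤ k.1 := Nat.lt_succ_iff.1 hi
          dsimp only
          rw [if_pos (show i ≤ k from hi'), (hb i).1 (by omega), ← (h2 i).1 (by omega)]
          rcases hi'.lt_or_eq with hr | hr
          · exact (hk i).1 hr
          · obtain rfl : i = k := Fin.ext hr
            exact heq.symm
        · have hi' : i.1 = k.1 + 1 := hi
          dsimp only
          rw [if_neg (show ¬ i ≤ k from fun h => by have : i.1 ≤ k.1 := h; omega)]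
          exact Nat.zero_le _
  · rw [phi_apply, inFilter_topFrom]
    refine ⟨_, fun i hi => ?_, proj_mul_self _⟩
    have hi' : i.1 < k.1 := hi
    exact Function.update_of_ne (by rintro rfl; omega) _ _

/-- Take the largest `k` for which some `p_k(m)` is in the support. The second alternative of a
split would increase `k`, so the first always holds and the `k`-th entry can be raised indefinitely.
The support then contains the filter of `(m_1, …, m_{k-1}, ∞, …, ∞)`, which is maximal. -/
theorem exists_phi_of_splitAt {y : Character (InvT ℓ)} (hy : ∀ k m, SplitAt k m y) :
    ∃ w, y = phi w := by
  classical
  -- Minimizing `ℓ - k` with `Nat.find` selects the largest `k`.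
  have hne : ∃ n, ∃ k : Fin (ℓ + 1), k.1 = ℓ - n ∧ ∃ m, y.1 (projB k m) = true := by
    obtain ⟨e, he⟩ := y.2.2.2
    obtain ⟨k, m, rfl⟩ := exists_projB_of_character he
    exact ⟨ℓ - k.1, k, by omega, m, he⟩
  obtain ⟨k, hk, m, hm⟩ := Nat.find_spec hne
  have hmax : ∀ j : Fin (ℓ + 1), k.1 < j.1 → ∀ m', ¬ y.1 (projB j m') = true := by
    intro j hj m' h
    have := Nat.find_min' hne ⟨j, show j.1 = ℓ - (ℓ - j.1) by omega, m', h⟩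
    omega
  have hall : ∀ N : ℕ, y.1 (projB k fun i => if i.1 = k.1 then m i + N else m i) = true := by
    intro N
    induction N with
    | zero => simpa using hm
    | succ N ih =>
      rcases (Nat.lt_succ_iff.1 k.2).lt_or_eq with hkl | hkl
      · rcases hy ⟨k.1, hkl⟩ _ ih with h | h
        · refine (congrArg (fun m' => y.1 (projB k m')) (funext fun i => ?_)).trans h
          by_cases hi : i = ⟨k.1, hkl⟩
          · subst hi
            simp [add_assoc]
          · have : i.1 ≠ k.1 := fun h => hi (Fin.ext h)
            simp [Function.update_of_ne hi, this]
        · exact absurd h (hmax _ (Nat.lt_succ_self _) _)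
      -- For `k = ℓ` there is no coordinate to raise, and the family is constant in `N`.
      · refine (congrArg (fun m' => y.1 (projB k m')) (funext fun i => ?_)).trans ih
        have : i.1 ≠ k.1 := by omega
        simp [this]
  have hle : ∀ e, (phi (topFrom k m)).1 e = true → y.1 e = true := by
    intro e he
    rw [phi_apply, inFilter_topFrom] at he
    obtain ⟨M, hM, he⟩ := he
    refine character_mono he (character_mono ?_ (hall (∑ i, M i)))
    refine projB_mul_projB_iff.2 fun b hb i => ⟨fun hi => ?_, fun hi => ?_⟩
    · have h3 := (hb i).1 hi
      dsimp only at h3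
      rw [if_neg hi.ne] at h3
      rw [h3, hM i hi]
    · have h3 := (hb i).2 hi
      dsimp only at h3
      rw [if_pos hi] at h3
      have := Finset.single_le_sum (f := M) (fun _ _ => Nat.zero_le _) (Finset.mem_univ i)
      omega
  refine ⟨topFrom k m, Subtype.ext (funext fun e => ?_)⟩
  rw [Bool.eq_iff_iff]
  exact ⟨isUltra_phi _ y hle e, hle e⟩

/-- Respecting every split is a closed condition that holds for ultrafilters and leaves only the
`φ(w)`. As each `φ(w)` is itself an ultrafilter, taking the closure adds nothing. -/
theorem tightSpectrum_eq_range : tightSpectrum (InvT ℓ) = Set.range phi := by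
  apply Set.Subset.antisymm
  · have hc : IsClosed {y : Character (InvT ℓ) | ∀ k m, SplitAt k m y} := by
      simp only [Set.ofPred_forall]
      exact isClosed_iInter fun k => isClosed_iInter fun m => isClosed_setOf_splitAt k m
    intro y hy
    have h1 := closure_minimal (t := {y : Character (InvT ℓ) | ∀ k m, SplitAt k m y})
      (fun x (hx : IsUltra x) k m => splitAt_of_isUltra hx k m) hc hy
    obtain ⟨w, rfl⟩ := exists_phi_of_splitAt h1
    exact ⟨w, rfl⟩
  · rintro _ ⟨w, rfl⟩
    exact subset_closure (isUltra_phi w)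

theorem phi_mem_tightSpectrum (w : Fin ℓ → ℕ∞) : phi w ∈ tightSpectrum (InvT ℓ) := by
  rw [tightSpectrum_eq_range]
  exact ⟨w, rfl⟩

/-! ## The isomorphism -/

/-- This is what the formula for `ψ` is designed to achieve. The entries `|x_{r+1}|` and `x_{r+1} +
|x_{r+1}|` are natural numbers with difference `x_{r+1}`, and the choice of `t` makes the exponent
equal to `z`. -/
theorem translates_psiB (a : SheuSigma ℓ) : Translates (psiB a) a.1.1 a.1.2.1 := by
  have hd : ∀ i : Fin ℓ, i.1 ≤ (firstTop a.1.2.2).1 →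
      (psiN a i : ℤ) - psiM a i = a.1.2.1 i := by
    intro i hi
    unfold psiN psiM
    rcases hi.lt_or_eq with h | h
    · rw [if_pos h, if_pos h]
      have := a.2.1 i (ne_top_of_lt_firstTop h)
      omega
    · rw [if_neg h.not_lt, if_neg h.not_lt, if_pos h, if_pos h]
      omega
  have h1 : disp (firstTop a.1.2.2) (psiM a) (psiN a) = a.1.2.1 := by
    funext i
    unfold disp
    split_ifs with hi
    · exact hd i hi
    · exact (x_eq_zero_of_firstTop_lt (not_le.1 hi)).symm
  have h2 : expo (firstTop a.1.2.2) (psiT a) (psiM a) (psiN a) = a.1.1 := by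
    have h3 : (∑ i : Fin ℓ, if i.1 ≤ (firstTop a.1.2.2).1 then (psiM a i : ℤ) - psiN a i else 0) =
        - ∑ i : Fin ℓ, if i.1 ≤ (firstTop a.1.2.2).1 then a.1.2.1 i else 0 := by
      rw [← Finset.sum_neg_distrib]
      refine Finset.sum_congr rfl fun i _ => ?_
      split_ifs with hi
      · rw [← hd i hi]; ring
      · simp
    unfold expo
    rw [h3]
    split_ifs with hr
    -- If `w` is finite, the exponent contains `t`, which compensates the sum of the `x_j`.
    · unfold psiT
      have h4 : ∀ i : Fin ℓ, (if i.1 ≤ (firstTop a.1.2.2).1 then a.1.2.1 i else 0) =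
          if i.1 < (firstTop a.1.2.2).1 then a.1.2.1 i else 0 := by
        intro i
        rw [if_pos (by omega), if_pos (by omega)]
      simp only [h4]
      ring
    -- If `w` has an infinite coordinate, `t` does not occur in the exponent, and the condition on
    -- `z` in `Σ` gives the value.
    · have hr' : (firstTop a.1.2.2).1 < ℓ := by omega
      rw [(a.2.2 ⟨_, hr'⟩ (eq_top_of_eq_firstTop rfl)).2, add_zero, ← Finset.sum_filter]
      congr 1
      refine Finset.sum_congr (Finset.ext fun i => ?_) fun _ _ => rfl
      simp [Fin.le_def]
  have h := translates_elemB (firstTop a.1.2.2) (psiT a) (psiM a) (psiN a)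
  rwa [h1, h2] at h

theorem psi_eq_germ_iff {a : SheuSigma ℓ} {y : Character (InvT ℓ)} {s : InvT ℓ}
    {hs : y ∈ domain s} {z : ℤ} {x : Fin ℓ → ℤ} (h : Translates s z x) :
    psi a = germ y s hs ↔ phi a.1.2.2 = y ∧ a.1.1 = z ∧ a.1.2.1 = x :=
  germ_eq_germ_iff (translates_psiB a) h

theorem psi_eq_psi_iff {a b : SheuSigma ℓ} : psi a = psi b ↔ (sheuSetoid ℓ) a b := by
  refine (psi_eq_germ_iff (translates_psiB b)).trans ?_
  rw [phi_eq_phi_iff]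
  constructor
  · rintro ⟨h1, h2, h3⟩
    exact ⟨h2, h3, h1⟩
  · rintro ⟨h1, h2, h3⟩
    exact ⟨h3, h1, h2⟩

theorem exists_translates {y : Character (InvT ℓ)} {s : InvT ℓ} (h : y ∈ domain s) :
    ∃ z x, Translates s z x := by
  rcases eq_zero_or_elemB s with rfl | ⟨k, r, m, n, rfl⟩
  · exact absurd rfl (ne_zero_of_mem_domain h)
  · exact ⟨_, _, translates_elemB k r m n⟩

/-- At the coordinates up to `k`, the domain condition gives `m i ≤ w i`, so `x + w` has no negative
entry. An infinite `w i` forces `k ≤ i`: nothing moves after `i`, and since `k < ℓ` the free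
parameter `r` is absent, which leaves minus the total displacement as the exponent. -/
theorem Translates.mem_sheuSigma {w : Fin ℓ → ℕ∞} {s : InvT ℓ} (h : phi w ∈ domain s) {z : ℤ}
    {x : Fin ℓ → ℤ} (hs : Translates s z x) :
    (∀ i, w i ≠ ⊤ → 0 ≤ x i + (w i).toNat) ∧
    ∀ i, w i = ⊤ → (∀ j, i < j → x j = 0) ∧ z = -∑ j ∈ Finset.Iic i, x j := by
  rcases eq_zero_or_elemB s with rfl | ⟨k, r, m, n, rfl⟩
  · exact absurd rfl (ne_zero_of_mem_domain h)
  obtain ⟨rfl, rfl⟩ := hs.unique (ne_zero_of_mem_domain h) (translates_elemB k r m n)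
  change (phi w).1 (rangeProj _) = true at h
  rw [rangeProj_elemB, phi_apply, inFilter_projB_iff] at h
  refine ⟨fun i hi => ?_, fun i hi => ?_⟩
  · unfold disp
    split_ifs with h1
    · have h2 : (m i : ℕ∞) ≤ w i := by
        rcases h1.lt_or_eq with h2 | h2
        · exact ((h i).1 h2).ge
        · exact (h i).2 h2
      have h3 : m i ≤ (w i).toNat := by
        rw [← ENat.natCast_toNat hi] at h2
        exact_mod_cast h2
      omega
    · omega
  · have hk : k.1 ≤ i.1 := by
      by_contra hk
      have := (h i).1 (by omega)
      rw [hi] at this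
      exact ENat.natCast_ne_top _ this.symm
    refine ⟨fun j hj => if_neg (by have : i.1 < j.1 := hj; omega), ?_⟩
    have hkl : k.1 ≠ ℓ := by omega
    unfold expo
    rw [if_neg hkl, add_zero, ← Finset.sum_neg_distrib]
    have h1 : ∀ j : Fin ℓ, -disp k m n j = if j.1 ≤ k.1 then (m j : ℤ) - n j else 0 := by
      intro j
      unfold disp
      split_ifs <;> ring
    simp only [h1]
    symm
    refine Finset.sum_subset (Finset.subset_univ _) fun j _ hj => if_neg ?_
    have : i < j := by simpa using hj
    have : i.1 < j.1 := this
    omega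

theorem psi_mem (a : SheuSigma ℓ) :
    germRng (psi a) ∈ tightSpectrum (InvT ℓ) ∧ germSrc (psi a) ∈ tightSpectrum (InvT ℓ) := by
  refine ⟨phi_mem_tightSpectrum a.1.2.2, ?_⟩
  have e : germSrc (psi a) = phi (sheuSrc a) := act_phi (translates_psiB a) (phi_mem_domain a)
  rw [e]
  exact phi_mem_tightSpectrum _

/-- The map `ψ` with values in the tight groupoid. -/
noncomputable def tightPsi (a : SheuSigma ℓ) : TightGroupoid (InvT ℓ) := ⟨psi a, psi_mem a⟩

theorem tightPsi_surjective : Function.Surjective (tightPsi : SheuSigma ℓ → _) := by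
  rintro ⟨⟨⟨y, s⟩, hs⟩, h1, h2⟩
  change y ∈ tightSpectrum _ at h1
  change y ∈ domain s at hs
  rw [tightSpectrum_eq_range] at h1
  obtain ⟨w, rfl⟩ := h1
  obtain ⟨z, x, hzx⟩ := exists_translates hs
  refine ⟨⟨(z, x, w), hzx.mem_sheuSigma hs⟩, Subtype.ext ?_⟩
  exact (psi_eq_germ_iff hzx).2 ⟨rfl, rfl, rfl⟩

/-! ### Continuity and openness -/

theorem continuous_tightPsi : Continuous (tightPsi : SheuSigma ℓ → _) := by
  refine Continuous.subtype_mk (continuous_generateFrom_iff.2 ?_) _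
  rintro _ ⟨s, U, hU, hUo, rfl⟩
  -- A point of `U` shows that `s` is nonzero and so has a well-defined vector.
  by_cases hne : U.Nonempty
  · obtain ⟨y, hy⟩ := hne
    obtain ⟨z, x, hzx⟩ := exists_translates (hU hy)
    have e : psi ⁻¹' {g | ∃ (y : Character (InvT ℓ)) (hy : y ∈ U), g = germ y s (hU hy)} =
        (fun a : SheuSigma ℓ => phi a.1.2.2) ⁻¹' U ∩
          (fun a : SheuSigma ℓ => (a.1.1, a.1.2.1)) ⁻¹' {(z, x)} := by
      ext a
      simp only [Set.mem_preimage, Set.mem_ofPred_eq, Set.mem_inter_iff, Set.mem_singleton_iff,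
        Prod.mk.injEq]
      constructor
      · rintro ⟨y, hy, h⟩
        obtain ⟨rfl, h2⟩ := (psi_eq_germ_iff hzx).1 h
        exact ⟨hy, h2⟩
      · rintro ⟨h1, h2⟩
        exact ⟨_, h1, (psi_eq_germ_iff hzx).2 ⟨rfl, h2⟩⟩
    rw [e]
    refine (hUo.preimage (continuous_phi.comp (by fun_prop))).inter
      ((isOpen_discrete _).preimage (by fun_prop))
  · convert isOpen_empty
    ext a
    simp only [Set.mem_preimage, Set.mem_ofPred_eq, Set.mem_empty_iff_false, iff_false]
    rintro ⟨y, hy, -⟩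
    exact hne ⟨y, hy⟩

/-- The image under `ψ` of a saturated open set is open. -/
theorem isOpen_image_tightPsi {V : Set (SheuSigma ℓ)} (hV : IsOpen V)
    (hsat : ∀ a b, (sheuSetoid ℓ) a b → a ∈ V → b ∈ V) : IsOpen (tightPsi '' V) := by
  rw [isOpen_iff_forall_mem_open]
  rintro _ ⟨a, ha, rfl⟩
  obtain ⟨V', hV', rfl⟩ := isOpen_induced_iff.1 hV
  -- The bad points: those over which `psiB a` is defined but whose triple with the vector of `a`
  -- falls outside the open set. Their image under `φ` is compact, hence closed, and the germs of
  -- `psiB a` off that image form the required neighbourhood.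
  set C : Set (Fin ℓ → ℕ∞) :=
    {w | phi w ∈ domain (psiB a)} ∩ (fun w => (a.1.1, a.1.2.1, w)) ⁻¹' V'ᶜ with hC
  have hCc : IsClosed C :=
    (isClopen_setOf_phi _).1.inter (hV'.isClosed_compl.preimage (by fun_prop))
  have hCi : IsClosed (phi '' C) := (hCc.isCompact.image continuous_phi).isClosed
  have hD : IsOpen (domain (psiB a)) :=
    (isClopen_setOf_character (rangeProj (psiB a))).2
  have hU : domain (psiB a) ∩ (phi '' C)ᶜ ⊆ domain (psiB a) := Set.inter_subset_left
  have hθ : IsOpen {g | ∃ (y : Character (InvT ℓ))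
      (hy : y ∈ domain (psiB a) ∩ (phi '' C)ᶜ), g = germ y (psiB a) (hU hy)} :=
    TopologicalSpace.GenerateOpen.basic _ ⟨psiB a, _, hU, hD.inter hCi.isOpen_compl, rfl⟩
  refine ⟨_, ?_, hθ.preimage continuous_subtype_val, phi a.1.2.2, ⟨phi_mem_domain a, ?_⟩, rfl⟩
  · intro g hg
    obtain ⟨y, hy, hgy⟩ := hg
    obtain ⟨b, rfl⟩ := tightPsi_surjective g
    obtain ⟨rfl, h1, h2⟩ := (psi_eq_germ_iff (translates_psiB a)).1 hgy
    refine ⟨b, ?_, rfl⟩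
    by_contra hb
    refine hy.2 ⟨b.1.2.2, ⟨hy.1, fun h => hb ?_⟩, rfl⟩
    change (b.1.1, b.1.2.1, b.1.2.2) ∈ V'
    rw [h1, h2]
    exact h
  -- Here saturation enters: a bad `w` with `φ(w)` equal to the character of `a` would give an
  -- element equivalent to `a` outside the set.
  · rintro ⟨w, ⟨hw, hwV⟩, hwa⟩
    refine hwV (hsat a ⟨(a.1.1, a.1.2.1, w), (translates_psiB a).mem_sheuSigma hw⟩
      ⟨rfl, rfl, phi_eq_phi_iff.1 hwa.symm⟩ ha)

/-- The map induced by `ψ` on classes. -/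
noncomputable def inducedPsi : SheuGroupoid ℓ → TightGroupoid (InvT ℓ) :=
  Quotient.lift tightPsi fun _ _ h => Subtype.ext (psi_eq_psi_iff.2 h)

theorem inducedPsi_bijective : Function.Bijective (inducedPsi : SheuGroupoid ℓ → _) := by
  constructor
  · rintro ⟨a⟩ ⟨b⟩ h
    exact Quotient.sound (psi_eq_psi_iff.1 (congrArg Subtype.val h))
  · intro g
    obtain ⟨a, rfl⟩ := tightPsi_surjective g
    exact ⟨SheuGroupoid.mk a, rfl⟩

theorem continuous_inducedPsi : Continuous (inducedPsi : SheuGroupoid ℓ → _) :=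
  continuous_tightPsi.quotient_lift _

theorem isOpenMap_inducedPsi : IsOpenMap (inducedPsi : SheuGroupoid ℓ → _) := by
  intro V hV
  have e : inducedPsi '' V = tightPsi '' (SheuGroupoid.mk ⁻¹' V) := by
    ext g
    constructor
    · rintro ⟨⟨a⟩, ha, rfl⟩
      exact ⟨a, ha, rfl⟩
    · rintro ⟨a, ha, rfl⟩
      exact ⟨SheuGroupoid.mk a, ha, rfl⟩
  rw [e]
  refine isOpen_image_tightPsi hV fun a b h ha => ?_
  have h' : SheuGroupoid.mk a = SheuGroupoid.mk b := Quotient.sound h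
  change SheuGroupoid.mk b ∈ V
  rw [← h']
  exact ha

/-! ### Compatibility with products and inverses -/

theorem transfSrc_psi (a : SheuSigma ℓ) :
    transfSrc ⟨(phi a.1.2.2, psiB a), phi_mem_domain a⟩ = phi (sheuSrc a) :=
  act_phi (translates_psiB a) (phi_mem_domain a)

theorem composable_psi_iff {a b : SheuSigma ℓ} :
    phi b.1.2.2 = transfSrc ⟨(phi a.1.2.2, psiB a), phi_mem_domain a⟩ ↔
      trunc (sheuSrc a) = trunc b.1.2.2 := by
  rw [transfSrc_psi, phi_eq_phi_iff, eq_comm]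

/-- Composability on both sides is equality of `x + w` and `w'` up to the first infinite coordinate.
The products then have the same range character and the same vector, since vectors add. -/
theorem inducedPsi_pmul (g h : SheuGroupoid ℓ) :
    ArrowGroupoid.pmul (inducedPsi g) (inducedPsi h) =
      (ArrowGroupoid.pmul g h).map inducedPsi := by
  obtain ⟨a⟩ := g
  obtain ⟨b⟩ := h
  change tightMul (tightPsi a) (tightPsi b) =
    (sheuMul (SheuGroupoid.mk a) (SheuGroupoid.mk b)).map _
  by_cases hab : trunc (sheuSrc a) = trunc b.1.2.2
  · refine Eq.trans ?_ (congrArg (Option.map _) (sheuMul_eq_some hab)).symm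
    refine tightMul_eq_some_iff.2 ((germMul_eq_some (composable_psi_iff.2 hab)).trans ?_)
    exact congrArg some
      ((psi_eq_germ_iff (a := sigmaMul a b hab) ((translates_psiB a).mul (translates_psiB b))).2 ⟨rfl, rfl, rfl⟩).symm
  · have h1 : sheuMul (SheuGroupoid.mk a) (SheuGroupoid.mk b) = none := dif_neg hab
    rw [h1, Option.map_none, Option.eq_none_iff_forall_not_mem]
    intro c hc
    obtain ⟨h2, -⟩ := germMul_eq_some_iff.1 (tightMul_eq_some_iff.1 hc)
    exact hab (composable_psi_iff.1 h2)

theorem inducedPsi_inv (g : SheuGroupoid ℓ) :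
    inducedPsi (ArrowGroupoid.inv g) = ArrowGroupoid.inv (inducedPsi g) := by
  obtain ⟨a⟩ := g
  refine Subtype.ext ?_
  exact (psi_eq_germ_iff (a := sigmaInv a) (translates_psiB a).star).2
    ⟨(transfSrc_psi a).symm, rfl, rfl⟩

variable (ℓ) in
/-- The isomorphism of Sheu's groupoid with the tight groupoid. -/
noncomputable def sheuIso : TopGroupoidIso (SheuGroupoid ℓ) (TightGroupoid (InvT ℓ)) where
  toHomeomorph := (Equiv.ofBijective inducedPsi inducedPsi_bijective).toHomeomorphOfContinuousOpen
    continuous_inducedPsi isOpenMap_inducedPsi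
  map_pmul := inducedPsi_pmul
  map_inv := inducedPsi_inv

end QSphere

theorem mainTheorem2 (ℓ : ℕ) (hℓ : 0 < ℓ) :
    ∃ ψ : QSphere.SheuSigma ℓ → QSphere.InverseSemigroup₀.TightGroupoid (QSphere.InvT ℓ),
      (∀ a, (ψ a).1 = QSphere.psi a) ∧
      Continuous ψ ∧
      (∀ a b, (QSphere.sheuSetoid ℓ) a b → ψ a = ψ b) ∧
      ∃ Ψ : QSphere.TopGroupoidIso (QSphere.SheuGroupoid ℓ)
          (QSphere.InverseSemigroup₀.TightGroupoid (QSphere.InvT ℓ)),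
        ∀ a, Ψ.toFun (QSphere.SheuGroupoid.mk a) = ψ a :=
  ⟨QSphere.tightPsi, fun _ => rfl, QSphere.continuous_tightPsi,
    fun _ _ h => Subtype.ext (QSphere.psi_eq_psi_iff.2 h), QSphere.sheuIso ℓ, fun _ => rfl⟩
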